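/- Consider a Markov decision process with finite state set $\mathcal S$, finite or infinite action set $\mathcal A$ (policies are probability densities with respect to a fixed measure $\nu$ on $\mathcal A$; for discrete actions, the counting measure), transition probabilities $P(s'|s,a)$, rewards $r(s,a,s')$ and discount factor $\gamma\in[0,1)$. Data $(s_t,a_t)_{t\ge 0}$ are generated by a fixed behavior policy $\pi_b$ with $\pi_b(a|s)>0$ for all $s,a$; let $r_{t+1}=r(s_t,a_t,s_{t+1})$ and let $d$ be the steady-state distribution of the states under $\pi_b$, i.e. $d$ is stationary and $\Pr(s_t=s)\to d(s)$ for all $s$ (e.g. $s_0\sim d$). Let $\pi_w$, $w\in\mathbb R^K$, be parametrized target policies such that for every $w$ the expected one-step rewards under $\pi_w$ exist; write $\rho_t=\pi_w(a_t|s_t)/\pi_b(a_t|s_t)$ and let $V^{\pi_w}$ be the state-value function of $\pi_w$. Let $\phi:\mathcal S\to\mathbb R^n$ be a feature map with one coordinate identically equal to $1$, and set $\phi_t=\phi(s_t)$. For every $w$ let $\theta(w)\in\mathbb R^n$ be a GTD(1)-solution, i.e. $\lim_{t\to\infty}\mathbb E[\rho_t\,(r_{t+1}+\gamma\theta(w)^\top\phi_{t+1}-\theta(w)^\top\phi_t)\,e_t]=0$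 with $e_t=\phi_t+\gamma\rho_{t-1}e_{t-1}$, $e_{-1}=0$, or an MSE-solution, i.e. a minimizer of $\theta\mapsto\sum_s d(s)\,(V^{\pi_w}(s)-\theta^\top\phi(s))^2$. Let $$J(w)=\sum_s d(s)\,\theta(w)^\top\phi(s)=\theta(w)^\top\mathbb E_{s_t\sim d}[\phi_t].$$ Fix $w$ such that, for all $s,a$, $\pi_w(a|s)>0$ and $v\mapsto\pi_v(a|s)$ is differentiable at $w$. Assume also that there are $\varepsilon>0$ and $g:\mathcal S\times\mathcal A\to\mathbb R$ such that $|\pi_v(a|s)-\pi_w(a|s)|\le g(s,a)\,\|v-w\|$ whenever $\|v-w\|<\varepsilon$, and such that $g(s,\cdot)$ and $g(s,\cdot)P(s'|s,\cdot)r(s,\cdot,s')$ are $\nu$-integrable for all $s,s'$ (this is automatic if $\mathcal A$ is finite, and if $\nabla\log\pi_w(a|s)$ is bounded uniformly in $(w,s,a)$). Let $\delta_t=r_{t+1}+\gamma\theta(w)^\top\phi_{t+1}-\theta(w)^\top\phi_t$. Then $J$ is differentiable at $w$, the random vectors $\rho_t\delta_t\psi_t$ are integrable, and $$\nabla J(w)=\lim_{t\to\infty}\mathbb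 E[\rho_t\,\delta_t\,\psi_t],$$ where $\psi_t=f_t\,\nabla\log\pi_w(a_t|s_t)+\gamma\rho_{t-1}\psi_{t-1}$ and $f_t=1+\gamma\rho_{t-1}f_{t-1}$, with $\psi_{-1}=0$ and $f_{-1}=0$. -/

import Mathlib

open MeasureTheory ProbabilityTheory Filter
open scoped Topology Gradient ENNReal

namespace RL

/-- A Markov decision process with finite state set `S` and an arbitrary (finite or infinite)
action space `A`: transition probabilities `P s a s' = P(s' | s, a)` and rewards
`r s a s'`. -/
structure MDP (S A : Type*) [Fintype S] [MeasurableSpace A] where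
  P : S → A → S → ℝ
  r : S → A → S → ℝ
  P_nonneg : ∀ s a s', 0 ≤ P s a s'
  P_sum : ∀ s a, ∑ s', P s a s' = 1
  P_meas : ∀ s s', Measurable fun a => P s a s'
  r_meas : ∀ s s', Measurable fun a => r s a s'

/-- A stationary stochastic policy `π(a | s)`, given by a density with respect to a fixed reference
measure `ν` on actions (counting measure for discrete actions, Lebesgue measure for continuous
ones). -/
structure Policy (S A : Type*) [MeasurableSpace A] (ν : Measure A) where
  dens : S → A → ℝ
  nonneg : ∀ s a, 0 ≤ dens s a
  meas : ∀ s, Measurable (dens s)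
  lintegral_eq_one : ∀ s, ∫⁻ a, ENNReal.ofReal (dens s a) ∂ν = 1

section Trajectories

variable {S A : Type*} [Fintype S] [MeasurableSpace S] [DiscreteMeasurableSpace S]
  [MeasurableSpace A] {ν : Measure A}

/-- The action distribution `π(· | s)` as a Markov kernel. -/
noncomputable def Policy.kernel (π : Policy S A ν) : Kernel S A :=
  Kernel.ofFunOfCountable fun s => ν.withDensity fun a => ENNReal.ofReal (π.dens s a)

instance (π : Policy S A ν) : IsMarkovKernel π.kernel where
  isProbabilityMeasure s := ⟨by
    change (ν.withDensity fun a => ENNReal.ofReal (π.dens s a)) Set.univ = 1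
    rw [withDensity_apply _ MeasurableSet.univ, Measure.restrict_univ, π.lintegral_eq_one s]⟩

/-- The next-state distribution `P(· | s, a)` as a Markov kernel. -/
noncomputable def MDP.kernel (M : MDP S A) : Kernel (S × A) S where
  toFun p := ∑ s' : S, ENNReal.ofReal (M.P p.1 p.2 s') • Measure.dirac s'
  measurable' := by
    refine Measure.measurable_of_measurable_coe _ fun B _ => ?_
    simp only [Measure.coe_finsetSum, Finset.sum_apply, Measure.smul_apply, smul_eq_mul]
    refine Finset.measurable_sum _ fun s' _ => Measurable.mul_const ?_ _
    exact (measurable_from_prod_countable_right fun s => M.P_meas s s').ennreal_ofReal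

instance (M : MDP S A) : IsMarkovKernel M.kernel where
  isProbabilityMeasure p := ⟨by
    change (∑ s' : S, ENNReal.ofReal (M.P p.1 p.2 s') • Measure.dirac s') Set.univ = 1
    simp only [Measure.coe_finsetSum, Finset.sum_apply, Measure.smul_apply, smul_eq_mul,
      measure_univ, mul_one]
    rw [← ENNReal.ofReal_sum_of_nonneg fun s' _ => M.P_nonneg _ _ _, M.P_sum, ENNReal.ofReal_one]⟩

/-- One step `(s_t, a_t) ↦ (s_{t+1}, a_{t+1})` under policy `π`: first `s_{t+1} ~ P(· | s_t, a_t)`,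
then `a_{t+1} ~ π(· | s_{t+1})`. -/
noncomputable def stepKernel (M : MDP S A) (π : Policy S A ν) : Kernel (S × A) (S × A) :=
  M.kernel.compProd (π.kernel.prodMkLeft (S × A))

instance (M : MDP S A) (π : Policy S A ν) : IsMarkovKernel (stepKernel M π) := by
  unfold stepKernel; infer_instance

/-- The law of the whole trajectory `((s_t, a_t))_{t ≥ 0}` when `s_0 ~ μ₀` and the agent follows
the policy `π`. -/
noncomputable def trajLaw (M : MDP S A) (π : Policy S A ν) (μ₀ : Measure S) :
    Measure (ℕ → S × A) :=
  Kernel.trajMeasure (X := fun _ => S × A) (μ₀.compProd π.kernel)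
    fun t => (stepKernel M π).comap (fun h => h ⟨t, Finset.mem_Iic.2 le_rfl⟩)
      (measurable_pi_apply _)

/-- The state `s_t` along a trajectory. -/
def state (t : ℕ) (x : ℕ → S × A) : S := (x t).1

/-- The action `a_t` along a trajectory. -/
def action (t : ℕ) (x : ℕ → S × A) : A := (x t).2

/-- The reward `r_{t+1} = r(s_t, a_t, s_{t+1})` along a trajectory. -/
def reward (M : MDP S A) (t : ℕ) (x : ℕ → S × A) : ℝ :=
  M.r (state t x) (action t x) (state (t + 1) x)

/-- The state-value function `V^π(s) = E_π[r_{t+1} + γ r_{t+2} + ⋯ | s_t = s]`. -/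
noncomputable def value (M : MDP S A) (γ : ℝ) (π : Policy S A ν) (s : S) : ℝ :=
  ∫ x, ∑' k : ℕ, γ ^ k * reward M k x ∂(trajLaw M π (Measure.dirac s))

/-- The expected one-step rewards under `π` exist (so that `V^π` is defined); automatic for bounded
rewards. -/
def RewardIntegrable (M : MDP S A) (π : Policy S A ν) : Prop :=
  ∀ s s', Integrable (fun a => π.dens s a * (M.P s a s' * M.r s a s')) ν

/-- `d` is the steady-state distribution of the states visited by the behavior policy `πb`: a
stationary distribution of the state chain, and the limit of the law of `s_t`. The latter holds
trivially if the process starts in steady state (`s_0 ~ d`), and for every initial law if the chain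
is irreducible and aperiodic. -/
structure IsSteadyState (M : MDP S A) (πb : Policy S A ν) (μ₀ : Measure S) (d : S → ℝ) :
    Prop where
  nonneg : ∀ s, 0 ≤ d s
  sum_eq_one : ∑ s, d s = 1
  stationary : ∀ s', ∑ s, d s * ∫ a, πb.dens s a * M.P s a s' ∂ν = d s'
  tendsto : ∀ s, Tendsto (fun t => (trajLaw M πb μ₀).real {x | state t x = s}) atTop (𝓝 (d s))

/-- Importance ratio `ρ_t = π(a_t | s_t) / π_b(a_t | s_t)`. -/
noncomputable def rho (πb π : Policy S A ν) (t : ℕ) (x : ℕ → S × A) : ℝ :=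
  π.dens (state t x) (action t x) / πb.dens (state t x) (action t x)

/-- TD error `δ_t = r_{t+1} + γ θᵀφ(s_{t+1}) - θᵀφ(s_t)`. -/
def tdError {n : ℕ} (M : MDP S A) (γ : ℝ) (φ : S → Fin n → ℝ) (θ : Fin n → ℝ) (t : ℕ)
    (x : ℕ → S × A) : ℝ :=
  reward M t x + γ * (θ ⬝ᵥ φ (state (t + 1) x)) - θ ⬝ᵥ φ (state t x)

/-- Eligibility trace with `λ = 1`: `e_t = φ(s_t) + γ ρ_{t-1} e_{t-1}`, with `e_{-1} = 0`. -/
noncomputable def eTrace {n : ℕ} (γ : ℝ) (πb π : Policy S A ν) (φ : S → Fin n → ℝ) :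
    ℕ → (ℕ → S × A) → Fin n → ℝ
  | 0, x => φ (state 0 x)
  | t + 1, x => φ (state (t + 1) x) + (γ * rho πb π t x) • eTrace γ πb π φ t x

/-- `f_t = 1 + γ ρ_{t-1} f_{t-1}`, with `f_{-1} = 0`. -/
noncomputable def fTrace (γ : ℝ) (πb π : Policy S A ν) : ℕ → (ℕ → S × A) → ℝ
  | 0, _ => 1
  | t + 1, x => 1 + γ * rho πb π t x * fTrace γ πb π t x

/-- `∇ log π_w(a | s)`, the gradient with respect to the policy parameter `w`. -/
noncomputable def score {K : ℕ} (π : EuclideanSpace ℝ (Fin K) → Policy S A ν)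
    (w : EuclideanSpace ℝ (Fin K)) (s : S) (a : A) : EuclideanSpace ℝ (Fin K) :=
  ∇ (fun v => Real.log ((π v).dens s a)) w

/-- `ψ_t = f_t ∇ log π_w(a_t | s_t) + γ ρ_{t-1} ψ_{t-1}`, with `ψ_{-1} = 0`. -/
noncomputable def psiTrace {K : ℕ} (γ : ℝ) (πb : Policy S A ν)
    (π : EuclideanSpace ℝ (Fin K) → Policy S A ν) (w : EuclideanSpace ℝ (Fin K)) :
    ℕ → (ℕ → S × A) → EuclideanSpace ℝ (Fin K)
  | 0, x => fTrace γ πb (π w) 0 x • score π w (state 0 x) (action 0 x)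
  | t + 1, x => fTrace γ πb (π w) (t + 1) x • score π w (state (t + 1) x) (action (t + 1) x) +
      (γ * rho πb (π w) t x) • psiTrace γ πb π w t x

/-- `θ` is a GTD(1)-solution for the target policy `π`: `E[ρ_t δ_t e_t] = 0` in the limit
`t → ∞`, the data being generated by the behavior policy `πb`. -/
def IsGTD1Solution {n : ℕ} (M : MDP S A) (γ : ℝ) (πb π : Policy S A ν) (μ₀ : Measure S)
    (φ : S → Fin n → ℝ) (θ : Fin n → ℝ) : Prop :=
  Tendsto (fun t => ∫ x, (rho πb π t x * tdError M γ φ θ t x) • eTrace γ πb π φ t x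
    ∂(trajLaw M πb μ₀)) atTop (𝓝 0)

/-- `MSE(θ) = ∑_s d(s) (V^π(s) - θᵀφ(s))²`. -/
noncomputable def mse {n : ℕ} (M : MDP S A) (γ : ℝ) (π : Policy S A ν) (d : S → ℝ)
    (φ : S → Fin n → ℝ) (θ : Fin n → ℝ) : ℝ :=
  ∑ s, d s * (value M γ π s - θ ⬝ᵥ φ s) ^ 2

/-- `θ` is an MSE-solution for the target policy `π`: it minimizes the mean-square error. -/
def IsMSESolution {n : ℕ} (M : MDP S A) (γ : ℝ) (π : Policy S A ν) (d : S → ℝ)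
    (φ : S → Fin n → ℝ) (θ : Fin n → ℝ) : Prop :=
  ∀ θ', mse M γ π d φ θ ≤ mse M γ π d φ θ'

/-- The objective `J(w) = θ(w)ᵀ E[φ_t]`, the expectation being over the distribution `d`. -/
def objective {K n : ℕ} (d : S → ℝ) (φ : S → Fin n → ℝ)
    (θ : EuclideanSpace ℝ (Fin K) → Fin n → ℝ) (w : EuclideanSpace ℝ (Fin K)) : ℝ :=
  θ w ⬝ᵥ ∑ s, d s • φ s

/-- Regularity of the parametrized policy at `w`: `∇ log π_w(a | s)` exists, and the difference
quotients of `v ↦ π_v(a | s)` at `w` are dominated, locally in `v`, by a function that is integrable,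
also against the rewards. The last condition is automatic for a finite action set, and follows from
`sup ‖∇ log π_w(a | s)‖ < ∞` whenever the expected absolute rewards under `π_w` are finite. -/
structure PolicyRegularAt {K : ℕ} (M : MDP S A) (π : EuclideanSpace ℝ (Fin K) → Policy S A ν)
    (w : EuclideanSpace ℝ (Fin K)) : Prop where
  pos : ∀ s a, 0 < (π w).dens s a
  diff : ∀ s a, DifferentiableAt ℝ (fun v => (π v).dens s a) w
  dominated : ∃ ε > 0, ∃ g : S → A → ℝ,
    (∀ s, Integrable (g s) ν) ∧
    (∀ s s', Integrable (fun a => g s a * (M.P s a s' * M.r s a s')) ν) ∧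
    ∀ s a v, ‖v - w‖ < ε → |(π v).dens s a - (π w).dens s a| ≤ g s a * ‖v - w‖

end Trajectories

end RL

/-! Write `P`, `R`, `V` for the transition matrix, mean reward and value function of `π_w`, `Φθ` for
the vector of values `θᵀφ(s)`, and `∂` for a directional derivative in `w`. Since one feature is
constant, both kinds of solution satisfy `d (V - Φθ) = 0`, so `J = d V`, and no regularity of `θ` in
`w` is needed. Differentiating `V = R + γ P V` gives `(1 - γ P) ∂V = ∂R + γ ∂P V`, hence `∂J = f (∂R
+ γ ∂P V)` with the row vector `f = d (1 - γ P)⁻¹`.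

The traces sample such row vectors. Multiplication by `ρ_t` replaces the behavior average over
actions by the target one, so the weights `F_t(s)`, the mean of `f_t` on `s_t = s`, satisfy `F_{t+1}
= d_{t+1} + γ F_t P` with `d_t` the law of `s_t`, and tend to `f`. Apart from its score term, `ψ_t`
is `γ` times a tail whose weights tend to `g = f ∂P + γ g P`. The mean TD error is `(1 - γ P)(V -
Φθ)` under the target density and `∂R + γ ∂P Φθ` under `∂π`, because the rows of `∂P` sum to zero.
The limit is therefore `f (∂R + γ ∂P Φθ) + γ g (1 - γ P)(V - Φθ) = f (∂R + γ ∂P V)`: the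
approximation `Φθ` cancels.

The bookkeeping is carried by `HasStateWeights`, the limits by
`exists_tendsto_of_discounted_recursion`, the identity `J = d V` by the two `sum_mul_value_sub`
lemmas, and the derivative by `PolicyRegularAt.fderiv_value`. -/

set_option linter.unusedSectionVars false

namespace RL

/-! ### Integration against the policy and transition kernels. -/

section Kernels

variable {S A : Type*} [Fintype S] [MeasurableSpace S] [DiscreteMeasurableSpace S]
  [MeasurableSpace A] {ν : Measure A}

theorem Policy.kernel_apply (π : Policy S A ν) (s : S) :
    π.kernel s = ν.withDensity fun a => ENNReal.ofReal (π.dens s a) := rfl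

theorem Policy.integrable_kernel_iff (π : Policy S A ν) (s : S) {f : A → ℝ} :
    Integrable f (π.kernel s) ↔ Integrable (fun a => π.dens s a * f a) ν := by
  rw [π.kernel_apply, integrable_withDensity_iff_integrable_smul' (π.meas s).ennreal_ofReal
    (by simp)]
  simp [ENNReal.toReal_ofReal (π.nonneg s _)]

theorem Policy.integral_kernel (π : Policy S A ν) (s : S) (f : A → ℝ) :
    ∫ a, f a ∂π.kernel s = ∫ a, π.dens s a * f a ∂ν := by
  rw [π.kernel_apply, integral_withDensity_eq_integral_toReal_smul (π.meas s).ennreal_ofReal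
    (by simp)]
  simp [ENNReal.toReal_ofReal (π.nonneg s _)]

theorem Policy.integrable_dens (π : Policy S A ν) (s : S) : Integrable (π.dens s) ν := by
  simpa using (π.integrable_kernel_iff s (f := fun _ => 1)).1 (integrable_const _)

theorem Policy.integral_dens (π : Policy S A ν) (s : S) : ∫ a, π.dens s a ∂ν = 1 := by
  simpa using (π.integral_kernel s (fun _ => 1)).symm

theorem MDP.P_le_one (M : MDP S A) (s : S) (a : A) (s' : S) : M.P s a s' ≤ 1 := by
  rw [← M.P_sum s a]
  exact Finset.single_le_sum (fun i _ => M.P_nonneg s a i) (Finset.mem_univ s')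

theorem MDP.kernel_apply (M : MDP S A) (p : S × A) :
    M.kernel p = ∑ s' : S, ENNReal.ofReal (M.P p.1 p.2 s') • Measure.dirac s' := rfl

theorem MDP.integral_kernel (M : MDP S A) (p : S × A) (f : S → ℝ) :
    ∫ s', f s' ∂M.kernel p = ∑ s', M.P p.1 p.2 s' * f s' := by
  rw [M.kernel_apply, integral_finsetSum_measure]
  · refine Finset.sum_congr rfl fun s' _ => ?_
    rw [integral_smul_measure, integral_dirac, ENNReal.toReal_ofReal (M.P_nonneg _ _ _),
      smul_eq_mul]
  · intro s' _
    exact (integrable_dirac (by simp)).smul_measure (by simp)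

theorem measurable_uncurry_of_discrete {E : Type*} [MeasurableSpace E] {q : S → A → E}
    (hq : ∀ s, Measurable (q s)) : Measurable fun p : S × A => q p.1 p.2 :=
  measurable_from_prod_countable_right hq

/-- `q` is measurable and integrable against the action distribution of the policy in each state. -/
structure Policy.IntegrableFn (π : Policy S A ν) (q : S → A → ℝ) : Prop where
  measurable : ∀ s, Measurable (q s)
  integrable : ∀ s, Integrable (fun a => π.dens s a * q s a) ν

namespace Policy.IntegrableFn

variable {π : Policy S A ν} {q u : S → A → ℝ}

theorem abs (hq : π.IntegrableFn q) : π.IntegrableFn fun s a => |q s a| where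
  measurable s := (hq.measurable s).abs
  integrable s := by
    have := (hq.integrable s).abs
    simpa only [abs_mul, abs_of_nonneg (π.nonneg s _)] using this

theorem mul_state (hq : π.IntegrableFn q) (c : S → ℝ) :
    π.IntegrableFn fun s a => q s a * c s where
  measurable s := (hq.measurable s).mul_const _
  integrable s := by
    simpa only [mul_assoc] using (hq.integrable s).mul_const (c s)

theorem const (π : Policy S A ν) (c : ℝ) : π.IntegrableFn fun _ _ => c where
  measurable _ := measurable_const
  integrable s := (π.integrable_dens s).mul_const c

theorem mul_P (hq : π.IntegrableFn q) (M : MDP S A) (s' : S) :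
    π.IntegrableFn fun s a => q s a * M.P s a s' where
  measurable s := (hq.measurable s).mul (M.P_meas s s')
  integrable s := by
    have := (hq.integrable s).mul_bdd (c := 1) (M.P_meas s s').aestronglyMeasurable
      (ae_of_all _ fun a => by
        rw [Real.norm_of_nonneg (M.P_nonneg _ _ _)]; exact M.P_le_one _ _ _)
    simpa only [mul_assoc] using this

theorem sum {ι : Type*} (I : Finset ι) {q : ι → S → A → ℝ} (hq : ∀ i, π.IntegrableFn (q i)) :
    π.IntegrableFn fun s a => ∑ i ∈ I, q i s a where
  measurable s := Finset.measurable_fun_sum _ fun i _ => (hq i).measurable s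
  integrable s := by
    simp only [Finset.mul_sum]
    exact integrable_finsetSum _ fun i _ => (hq i).integrable s

theorem measurable_uncurry (hq : π.IntegrableFn q) : Measurable fun p : S × A => q p.1 p.2 :=
  measurable_uncurry_of_discrete hq.measurable

theorem integrable_stepKernel (hq : π.IntegrableFn q) (M : MDP S A) (p : S × A) :
    Integrable (fun z : S × A => q z.1 z.2) (stepKernel M π p) := by
  rw [stepKernel, integrable_compProd_iff hq.measurable_uncurry.aestronglyMeasurable]
  refine ⟨ae_of_all _ fun s' => ?_, .of_finite⟩
  simpa [Kernel.prodMkLeft_apply] using (π.integrable_kernel_iff s').2 (hq.integrable s')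

theorem integral_stepKernel (hq : π.IntegrableFn q) (M : MDP S A) (p : S × A) :
    ∫ z, q z.1 z.2 ∂stepKernel M π p =
      ∑ s', M.P p.1 p.2 s' * ∫ a, π.dens s' a * q s' a ∂ν := by
  have h := hq.integrable_stepKernel M p
  rw [stepKernel] at h ⊢
  rw [integral_compProd h, M.integral_kernel]
  simp [Kernel.prodMkLeft_apply, π.integral_kernel]

end Policy.IntegrableFn

end Kernels

/-! ### The filtration of the trajectory. -/

section History

variable {S A : Type*} [MeasurableSpace S] [MeasurableSpace A]

/-- The σ-algebra generated by the trajectory up to time `t`. -/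
abbrev history (S A : Type*) [MeasurableSpace S] [MeasurableSpace A] (t : ℕ) :
    MeasurableSpace (ℕ → S × A) :=
  MeasurableSpace.comap (Preorder.frestrictLe (π := fun _ => S × A) t) inferInstance

theorem history_mono {t u : ℕ} (h : t ≤ u) : history S A t ≤ history S A u := by
  unfold history
  rw [← Preorder.frestrictLe₂_comp_frestrictLe (π := fun _ => S × A) h,
    ← MeasurableSpace.comap_comp]
  exact MeasurableSpace.comap_mono (Preorder.measurable_frestrictLe₂ h).comap_le

theorem measurable_history_apply (t : ℕ) :
    Measurable[history S A t] fun x : ℕ → S × A => x t :=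
  (measurable_pi_apply (⟨t, Finset.mem_Iic.2 le_rfl⟩ : Finset.Iic t)).comp
    (comap_measurable (Preorder.frestrictLe (π := fun _ => S × A) t))

end History

/-! ### The Markov property and state weights of trace variables. -/

section Weights

variable {S A : Type*} [Fintype S] [MeasurableSpace S] [DiscreteMeasurableSpace S]
  [MeasurableSpace A] {ν : Measure A} {M : MDP S A} {πb : Policy S A ν} {μ₀ : Measure S}

instance [IsProbabilityMeasure μ₀] : IsProbabilityMeasure (trajLaw M πb μ₀) := by
  unfold trajLaw; infer_instance

theorem trajLaw_map_zero [IsProbabilityMeasure μ₀] :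
    (trajLaw M πb μ₀).map (fun x => x 0) = μ₀.compProd πb.kernel := by
  let e : (Finset.Iic 0 → S × A) ≃ᵐ S × A := MeasurableEquiv.piUnique fun _ : Finset.Iic 0 => S × A
  have h : (trajLaw M πb μ₀).map (Preorder.frestrictLe (π := fun _ => S × A) 0) =
      (μ₀.compProd πb.kernel).map e.symm := by
    rw [trajLaw, Kernel.trajMeasure, Measure.map_comp _ _ (Preorder.measurable_frestrictLe 0),
      Kernel.traj_map_frestrictLe, Kernel.partialTraj_self, Measure.id_comp]
  calc (trajLaw M πb μ₀).map (fun x => x 0)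
      = ((trajLaw M πb μ₀).map (Preorder.frestrictLe (π := fun _ => S × A) 0)).map e :=
        (Measure.map_map (f := Preorder.frestrictLe (π := fun _ => S × A) 0) e.measurable
          (Preorder.measurable_frestrictLe 0)).symm
    _ = μ₀.compProd πb.kernel := by
        rw [h, Measure.map_map e.measurable e.symm.measurable, e.self_comp_symm, Measure.map_id]

theorem trajLaw_map_succ [IsProbabilityMeasure μ₀] (t : ℕ) :
    (trajLaw M πb μ₀).map
        (fun x => (Preorder.frestrictLe (π := fun _ => S × A) t x, x (t + 1))) =
      ((trajLaw M πb μ₀).map (Preorder.frestrictLe (π := fun _ => S × A) t)).compProd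
        ((stepKernel M πb).comap (fun h => h ⟨t, Finset.mem_Iic.2 le_rfl⟩)
          (measurable_pi_apply _)) :=
  (Kernel.map_frestrictLe_trajMeasure_compProd_eq_map_trajMeasure ..).symm

/-- The Markov property, for a function `q` of the next state-action pair. -/
theorem integral_mul_next [IsProbabilityMeasure μ₀] {t : ℕ} {Y : (ℕ → S × A) → ℝ}
    (hY : Measurable[history S A t] Y) {q : S → A → ℝ} (hq : πb.IntegrableFn q)
    (h : Integrable (fun x => Y x * ∑ s', M.P (state t x) (action t x) s' *
      ∫ a, πb.dens s' a * |q s' a| ∂ν) (trajLaw M πb μ₀)) :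
    Integrable (fun x => Y x * q (state (t + 1) x) (action (t + 1) x)) (trajLaw M πb μ₀) ∧
    ∫ x, Y x * q (state (t + 1) x) (action (t + 1) x) ∂trajLaw M πb μ₀ =
      ∫ x, Y x * ∑ s', M.P (state t x) (action t x) s' * ∫ a, πb.dens s' a * q s' a ∂ν
        ∂trajLaw M πb μ₀ := by
  obtain ⟨y, hy, rfl⟩ := hY.exists_eq_measurable_comp
  have hm : Measurable
      (fun x : ℕ → S × A => (Preorder.frestrictLe (π := fun _ => S × A) t x, x (t + 1))) :=
    (Preorder.measurable_frestrictLe t).prodMk (measurable_pi_apply _)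
  have hG : Measurable fun z : ((_ : Finset.Iic t) → S × A) × (S × A) =>
      y z.1 * q z.2.1 z.2.2 :=
    (hy.comp measurable_fst).mul (hq.measurable_uncurry.comp measurable_snd)
  have hK : ∀ {q : S → A → ℝ}, πb.IntegrableFn q →
      Measurable fun z : (_ : Finset.Iic t) → S × A => y z *
        ∑ s', M.P (z ⟨t, Finset.mem_Iic.2 le_rfl⟩).1 (z ⟨t, Finset.mem_Iic.2 le_rfl⟩).2 s' *
          ∫ a, πb.dens s' a * q s' a ∂ν := fun {q} _ =>
    hy.mul (Finset.measurable_fun_sum _ fun s' _ =>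
      ((measurable_uncurry_of_discrete fun s => M.P_meas s s').comp
        (measurable_pi_apply _)).mul_const _)
  have hint : Integrable (fun z : ((_ : Finset.Iic t) → S × A) × (S × A) =>
      y z.1 * q z.2.1 z.2.2)
      ((trajLaw M πb μ₀).map
        (fun x => (Preorder.frestrictLe (π := fun _ => S × A) t x, x (t + 1)))) := by
    rw [trajLaw_map_succ, Measure.integrable_compProd_iff hG.aestronglyMeasurable]
    refine ⟨ae_of_all _ fun z => 
      (hq.integrable_stepKernel M (z ⟨t, Finset.mem_Iic.2 le_rfl⟩)).const_mul (y z), ?_⟩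
    -- The fibre integral of the norm is `|y|` times an average of `|q|`; this is why `h` is stated
    -- with `|q|`.
    have h' := ((integrable_map_measure (hK hq.abs).aestronglyMeasurable
      (Preorder.measurable_frestrictLe t).aemeasurable).2 h).norm
    refine h'.congr (ae_of_all _ fun z => ?_)
    simp only [norm_mul, Kernel.comap_apply, integral_const_mul]
    congr 1
    rw [Real.norm_of_nonneg]
    · exact (hq.abs.integral_stepKernel M _).symm
    · exact Finset.sum_nonneg fun s' _ => mul_nonneg (M.P_nonneg _ _ _)
        (integral_nonneg fun a => mul_nonneg (πb.nonneg _ _) (abs_nonneg _))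
  refine ⟨hint.comp_measurable hm, ?_⟩
  have h1 := integral_map (μ := trajLaw M πb μ₀) hm.aemeasurable hG.aestronglyMeasurable
  have h2 := integral_map (μ := trajLaw M πb μ₀)
    (Preorder.measurable_frestrictLe t).aemeasurable (hK hq).aestronglyMeasurable
  refine h1.symm.trans (Eq.trans ?_ h2)
  rw [trajLaw_map_succ] at hint ⊢
  rw [Measure.integral_compProd hint]
  refine integral_congr_ae (ae_of_all _ fun z => ?_)
  simp only [Kernel.comap_apply, integral_const_mul]
  rw [hq.integral_stepKernel M]

/-- `Z` depends on the trajectory up to time `t`, and `E[Z q(s_t, a_t)]` is the sum over states of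
`F s` times the mean of `q(s, ·)` under the behavior policy. -/
structure HasStateWeights (M : MDP S A) (πb : Policy S A ν) (μ₀ : Measure S) (t : ℕ)
    (Z : (ℕ → S × A) → ℝ) (F : S → ℝ) : Prop where
  measurable : Measurable[history S A t] Z
  integrable : ∀ {q : S → A → ℝ}, πb.IntegrableFn q →
    Integrable (fun x => Z x * q (state t x) (action t x)) (trajLaw M πb μ₀)
  integral : ∀ {q : S → A → ℝ}, πb.IntegrableFn q →
    ∫ x, Z x * q (state t x) (action t x) ∂trajLaw M πb μ₀ =
      ∑ s, F s * ∫ a, πb.dens s a * q s a ∂ν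

namespace HasStateWeights

variable {t : ℕ} {Z Z' : (ℕ → S × A) → ℝ} {F F' : S → ℝ}

theorem one [IsProbabilityMeasure μ₀] :
    HasStateWeights M πb μ₀ 0 (fun _ => 1) fun s => μ₀.real {s} := by
  have hm : Measurable fun x : ℕ → S × A => x 0 := measurable_pi_apply 0
  have hi : ∀ {q : S → A → ℝ}, πb.IntegrableFn q →
      Integrable (fun p : S × A => q p.1 p.2) (μ₀.compProd πb.kernel) := fun {q} hq => by
    rw [Measure.integrable_compProd_iff hq.measurable_uncurry.aestronglyMeasurable]
    exact ⟨ae_of_all _ fun s => (πb.integrable_kernel_iff s).2 (hq.integrable s), .of_finite⟩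
  refine ⟨measurable_const, fun {q} hq => ?_, fun {q} hq => ?_⟩
  · have := hi hq
    rw [← trajLaw_map_zero (M := M)] at this
    simpa only [one_mul] using! this.comp_measurable hm
  · have h := integral_map (μ := trajLaw M πb μ₀) hm.aemeasurable
      hq.measurable_uncurry.aestronglyMeasurable
    simp only [one_mul]
    refine h.symm.trans ?_
    rw [trajLaw_map_zero, Measure.integral_compProd (hi hq), integral_fintype .of_finite]
    simp [πb.integral_kernel]

theorem add (h : HasStateWeights M πb μ₀ t Z F) (h' : HasStateWeights M πb μ₀ t Z' F') :
    HasStateWeights M πb μ₀ t (fun x => Z x + Z' x) fun s => F s + F' s where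
  measurable := h.measurable.add h'.measurable
  integrable hq := by
    simp only [add_mul]
    exact (h.integrable hq).add (h'.integrable hq)
  integral hq := by
    simp only [add_mul, Finset.sum_add_distrib]
    rw [integral_add (h.integrable hq) (h'.integrable hq), h.integral hq, h'.integral hq]

theorem mul_state (h : HasStateWeights M πb μ₀ t Z F) (c : S → ℝ) :
    HasStateWeights M πb μ₀ t (fun x => Z x * c (state t x)) fun s => F s * c s where
  measurable := h.measurable.mul
    ((measurable_of_countable c).comp (measurable_fst.comp (measurable_history_apply t)))
  integrable hq := by
    simpa only [mul_assoc, mul_comm (c _)] using h.integrable (hq.mul_state c)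
  integral {q} hq := by
    have := h.integral (hq.mul_state c)
    simp only [mul_assoc, mul_comm (c _)] at this ⊢
    rw [this]
    refine Finset.sum_congr rfl fun s _ => ?_
    simp only [← mul_assoc, integral_mul_const]

/-- Conditioning on `(s_t, a_t)` turns a test function of the next pair into a test function of the
present pair that is again integrable under the behavior policy. The property of `Z` thus propagates
in time without any moment bound on products of ratios. -/
theorem advance [IsProbabilityMeasure μ₀] (h : HasStateWeights M πb μ₀ t Z F) {u : S → A → ℝ}
    (hu : πb.IntegrableFn u) :
    HasStateWeights M πb μ₀ (t + 1) (fun x => Z x * u (state t x) (action t x))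
      fun s' => ∑ s, F s * ∫ a, πb.dens s a * (u s a * M.P s a s') ∂ν := by
  have hY : Measurable[history S A t] fun x => Z x * u (state t x) (action t x) :=
    h.measurable.mul (hu.measurable_uncurry.comp (measurable_history_apply t))
  -- The constants `c s'` will be the action averages of `q s'`, or of `|q s'|`, in the next state.
  have key (c : S → ℝ) :
      πb.IntegrableFn fun s a => u s a * ∑ s', M.P s a s' * c s' := by
    simp only [Finset.mul_sum, ← mul_assoc]
    exact .sum _ fun s' => (hu.mul_P M s').mul_state fun _ => c s'
  have step {q : S → A → ℝ} (hq : πb.IntegrableFn q) := by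
    refine integral_mul_next hY hq (M := M) (μ₀ := μ₀) ?_
    have := h.integrable (key fun s' => ∫ a, πb.dens s' a * |q s' a| ∂ν)
    simpa only [mul_assoc] using this
  refine ⟨hY.mono (history_mono t.le_succ) le_rfl, fun hq => (step hq).1, fun {q} hq => ?_⟩
  rw [(step hq).2]
  have := h.integral (key fun s' => ∫ a, πb.dens s' a * q s' a ∂ν)
  simp only [← mul_assoc] at this ⊢
  rw [this]
  simp only [Finset.sum_mul]
  rw [Finset.sum_comm]
  refine Finset.sum_congr rfl fun s _ => ?_
  simp only [mul_assoc, ← Finset.mul_sum]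
  congr 1
  simp only [Finset.mul_sum, ← mul_assoc]
  rw [integral_finsetSum]
  · simp only [integral_mul_const]
  · intro s' _
    have := ((hu.mul_P M s').integrable s).mul_const (∫ a, πb.dens s' a * q s' a ∂ν)
    simpa only [mul_assoc] using this

/-- The mean of `Z h(s_t, a_t, s_{t+1})`. -/
theorem transition [IsProbabilityMeasure μ₀] (h : HasStateWeights M πb μ₀ t Z F)
    {r : S → A → S → ℝ} (hr : ∀ s s', Measurable fun a => r s a s')
    (hi : ∀ s s', Integrable (fun a => πb.dens s a * (M.P s a s' * r s a s')) ν) :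
    Integrable (fun x => Z x * r (state t x) (action t x) (state (t + 1) x))
      (trajLaw M πb μ₀) ∧
    ∫ x, Z x * r (state t x) (action t x) (state (t + 1) x) ∂trajLaw M πb μ₀ =
      ∑ s, F s * ∑ s', ∫ a, πb.dens s a * (M.P s a s' * r s a s') ∂ν := by
  classical
  have hrP (s' : S) : πb.IntegrableFn fun s a => M.P s a s' * r s a s' :=
    ⟨fun s => (M.P_meas s s').mul (hr s s'), fun s => hi s s'⟩
  have hind (s' : S) : πb.IntegrableFn fun s _ => if s = s' then 1 else 0 := by
    simpa only [one_mul] using (Policy.IntegrableFn.const πb 1).mul_state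
      fun s => if s = s' then 1 else 0
  have hY (s' : S) :
      Measurable[history S A t] fun x => Z x * r (state t x) (action t x) s' :=
    h.measurable.mul ((measurable_uncurry_of_discrete fun s => hr s s').comp
      (measurable_history_apply t))
  have hsum (x : ℕ → S × A) (s' : S) : ∑ s'', M.P (state t x) (action t x) s'' *
      ∫ a, πb.dens s'' a * (if s'' = s' then 1 else 0) ∂ν = M.P (state t x) (action t x) s' := by
    simp only [integral_mul_const, πb.integral_dens]
    simp
  -- For a fixed next state `s'` the reward belongs to the past factor, and the test function of the
  -- next pair is the indicator of `s_{t+1} = s'`.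
  have hstep (s' : S) := by
    refine integral_mul_next (hY s') (hind s') (M := M) (μ₀ := μ₀) ?_
    have : ∀ s'', |if s'' = s' then (1 : ℝ) else 0| = if s'' = s' then 1 else 0 := fun s'' => by
      split_ifs <;> simp
    simp only [this, hsum]
    simpa only [mul_assoc, mul_comm (r _ _ _)] using h.integrable (hrP s')
  have hexp : (fun x => Z x * r (state t x) (action t x) (state (t + 1) x)) = fun x =>
      ∑ s', Z x * r (state t x) (action t x) s' * if state (t + 1) x = s' then 1 else 0 := by
    funext x; simp
  rw [hexp]
  refine ⟨integrable_finsetSum _ fun s' _ => (hstep s').1, ?_⟩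
  rw [integral_finsetSum _ fun s' _ => (hstep s').1]
  simp only [Finset.mul_sum]
  rw [Finset.sum_comm]
  refine Finset.sum_congr rfl fun s' _ => ?_
  rw [(hstep s').2]
  simp only [hsum, ← h.integral (hrP s')]
  simp only [mul_assoc, mul_comm (r _ _ _)]

end HasStateWeights

end Weights

/-! ### Discounted linear recursions for row vectors. -/

section LinearRecursions

theorem tendsto_zero_of_le_mul_add {a b : ℕ → ℝ} {γ : ℝ} (hγ0 : 0 ≤ γ) (hγ1 : γ < 1)
    (ha : ∀ t, 0 ≤ a t) (hb : Tendsto b atTop (𝓝 0)) (h : ∀ t, a (t + 1) ≤ γ * a t + b t) :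
    Tendsto a atTop (𝓝 0) := by
  rw [Metric.tendsto_atTop]
  intro ε hε
  -- With this bound on `b`, the level `ε / 2` is fixed by `x ↦ γ x + ε / 2 * (1 - γ)`.
  have hε' : 0 < ε / 2 * (1 - γ) := mul_pos (half_pos hε) (by linarith)
  obtain ⟨T, hT⟩ := eventually_atTop.1 (hb.eventually_lt_const hε')
  have hind : ∀ k, a (T + k) ≤ γ ^ k * a T + ε / 2 := by
    intro k
    induction k with
    | zero => simp; linarith
    | succ k ih =>
      have h1 := h (T + k)
      have h2 := hT (T + k) (by omega)
      have h3 := mul_le_mul_of_nonneg_left ih hγ0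
      rw [← add_assoc, pow_succ]
      nlinarith
  have hlim : Tendsto (fun k => γ ^ k * a T) atTop (𝓝 0) := by
    simpa using (tendsto_pow_atTop_nhds_zero_of_lt_one hγ0 hγ1).mul_const (a T)
  obtain ⟨N, hN⟩ := eventually_atTop.1 (hlim.eventually_lt_const (half_pos hε))
  refine ⟨T + N, fun n hn => ?_⟩
  obtain ⟨k, rfl⟩ := Nat.exists_eq_add_of_le (le_of_add_le_left hn)
  rw [Real.dist_eq, sub_zero, abs_of_nonneg (ha _)]
  linarith [hind k, hN k (by omega)]

variable {S : Type*} [Fintype S] {P : S → S → ℝ} {γ : ℝ}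

/-- Strict diagonal dominance: the off-diagonal row sum is `γ (1 - P s s)`, smaller than the
diagonal entry `1 - γ P s s`. -/
theorem det_one_sub_smul_ne_zero [DecidableEq S] (hγ0 : 0 ≤ γ) (hγ1 : γ < 1)
    (hP0 : ∀ s s', 0 ≤ P s s') (hP1 : ∀ s, ∑ s', P s s' = 1) :
    (1 - γ • Matrix.of P).det ≠ 0 := by
  refine det_ne_zero_of_sum_row_lt_diag fun s => ?_
  have h1 : ∑ s' ∈ Finset.univ.erase s, ‖(1 - γ • Matrix.of P) s s'‖ =
      γ * ∑ s' ∈ Finset.univ.erase s, P s s' := by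
    rw [Finset.mul_sum]
    refine Finset.sum_congr rfl fun s' hs' => ?_
    simp [Matrix.one_apply_ne (Finset.ne_of_mem_erase hs').symm, abs_of_nonneg (hP0 _ _),
      abs_of_nonneg hγ0]
  have h2 : P s s + ∑ s' ∈ Finset.univ.erase s, P s s' = 1 := by
    rw [Finset.add_sum_erase _ _ (Finset.mem_univ s), hP1]
  have h3 : 0 ≤ ∑ s' ∈ Finset.univ.erase s, P s s' := Finset.sum_nonneg fun _ _ => hP0 _ _
  rw [h1]
  refine lt_of_lt_of_le ?_ (le_abs_self _)
  simp only [Matrix.sub_apply, Matrix.one_apply_eq, Matrix.smul_apply, Matrix.of_apply,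
    smul_eq_mul]
  rw [eq_sub_of_add_eq h2]
  linarith

/-- A row vector driven by a discounted stochastic matrix converges to the fixed point. -/
theorem exists_tendsto_of_discounted_recursion (hγ0 : 0 ≤ γ) (hγ1 : γ < 1)
    (hP0 : ∀ s s', 0 ≤ P s s') (hP1 : ∀ s, ∑ s', P s s' = 1) {C : ℕ → S → ℝ} {c : S → ℝ}
    (hC : ∀ s, Tendsto (fun t => C t s) atTop (𝓝 (c s))) {F : ℕ → S → ℝ}
    (hF : ∀ t s', F (t + 1) s' = C (t + 1) s' + γ * ∑ s, F t s * P s s') :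
    ∃ f : S → ℝ, (∀ s, Tendsto (fun t => F t s) atTop (𝓝 (f s))) ∧
      ∀ s', f s' = c s' + γ * ∑ s, f s * P s s' := by
  classical
  have hdet := det_one_sub_smul_ne_zero hγ0 hγ1 hP0 hP1
  obtain ⟨f, hf⟩ : ∃ f : S → ℝ, ∀ s', f s' = c s' + γ * ∑ s, f s * P s s' := by
    refine ⟨Matrix.vecMul c (1 - γ • Matrix.of P)⁻¹, fun s' => ?_⟩
    have h : Matrix.vecMul (Matrix.vecMul c (1 - γ • Matrix.of P)⁻¹) (1 - γ • Matrix.of P) = c := by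
      rw [Matrix.vecMul_vecMul, Matrix.nonsing_inv_mul _ (isUnit_iff_ne_zero.2 hdet),
        Matrix.vecMul_one]
    have := congrFun h s'
    rw [Matrix.vecMul_sub, Matrix.vecMul_one, Matrix.vecMul_smul] at this
    simp only [Pi.sub_apply, Pi.smul_apply, smul_eq_mul] at this
    exact eq_add_of_sub_eq this
  refine ⟨f, fun s => ?_, hf⟩
  -- In the ℓ¹ norm, right multiplication by `γ P` contracts by `γ`, since the rows of `P` sum to
  -- one.
  have key : Tendsto (fun t => ∑ s, |F t s - f s|) atTop (𝓝 0) := by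
    refine tendsto_zero_of_le_mul_add hγ0 hγ1
      (fun t => Finset.sum_nonneg fun _ _ => abs_nonneg _)
      (b := fun t => ∑ s, |C (t + 1) s - c s|) ?_ fun t => ?_
    · have : Tendsto (fun t => ∑ s, |C t s - c s|) atTop (𝓝 (∑ s : S, |c s - c s|)) :=
        tendsto_finsetSum _ fun s _ => ((hC s).sub_const _).abs
      simpa using (tendsto_add_atTop_iff_nat 1).2 this
    · calc ∑ s', |F (t + 1) s' - f s'|
          ≤ ∑ s', (γ * ∑ s, |F t s - f s| * P s s' + |C (t + 1) s' - c s'|) := by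
            refine Finset.sum_le_sum fun s' _ => ?_
            have h1 : F (t + 1) s' - f s' =
                γ * ∑ s, (F t s - f s) * P s s' + (C (t + 1) s' - c s') := by
              rw [hF, hf s']
              simp only [sub_mul, Finset.sum_sub_distrib]
              ring
            rw [h1]
            refine (abs_add_le _ _).trans (add_le_add_left ?_ _)
            rw [abs_mul, abs_of_nonneg hγ0]
            refine mul_le_mul_of_nonneg_left ?_ hγ0
            refine (Finset.abs_sum_le_sum_abs _ _).trans_eq (Finset.sum_congr rfl fun s _ => ?_)
            rw [abs_mul, abs_of_nonneg (hP0 s s')]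
        _ = γ * ∑ s, |F t s - f s| + ∑ s, |C (t + 1) s - c s| := by
            rw [Finset.sum_add_distrib, ← Finset.mul_sum, Finset.sum_comm]
            simp only [← Finset.mul_sum, hP1, mul_one]
  have h0 : Tendsto (fun t => F t s - f s) atTop (𝓝 0) := by
    refine squeeze_zero_norm (fun t => ?_) key
    exact Finset.single_le_sum (f := fun s => |F t s - f s|) (fun _ _ => abs_nonneg _)
      (Finset.mem_univ s)
  simpa using h0.add_const (f s)

/-- If `f = c + γ f P` as row vectors, then `f (u - γ P u) = c u`. -/
theorem sum_mul_sub_discounted {f c : S → ℝ} (hf : ∀ s', f s' = c s' + γ * ∑ s, f s * P s s')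
    (u : S → ℝ) : ∑ s, f s * (u s - γ * ∑ s', P s s' * u s') = ∑ s, c s * u s := by
  have h1 : ∀ s, c s * u s = f s * u s - γ * ∑ s', f s' * P s' s * u s := fun s => by
    rw [← Finset.sum_mul, ← mul_assoc, ← sub_mul, hf s]
    simp
  simp only [h1, mul_sub, Finset.sum_sub_distrib, Finset.mul_sum]
  congr 1
  rw [Finset.sum_comm]
  exact Finset.sum_congr rfl fun _ _ => Finset.sum_congr rfl fun _ _ => by ring

end LinearRecursions

/-! ### Action averages against signed densities, and the mean TD error. -/

section Averages

variable {S A : Type*} [Fintype S] [MeasurableSpace S] [DiscreteMeasurableSpace S]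
  [MeasurableSpace A] {ν : Measure A}

/-- The transition probabilities averaged over the actions with respect to a (signed) density. -/
noncomputable def MDP.avgP (M : MDP S A) (ν : Measure A) (D : S → A → ℝ) (s s' : S) : ℝ :=
  ∫ a, D s a * M.P s a s' ∂ν

/-- The expected rewards averaged over the actions with respect to a (signed) density. -/
noncomputable def MDP.avgR (M : MDP S A) (ν : Measure A) (D : S → A → ℝ) (s : S) : ℝ :=
  ∑ s', ∫ a, D s a * (M.P s a s' * M.r s a s') ∂ν

/-- A signed action density for which `avgP` and `avgR` are meaningful. -/
structure MDP.IntegrableDensity (M : MDP S A) (ν : Measure A) (D : S → A → ℝ) : Prop where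
  measurable : ∀ s, Measurable (D s)
  integrable : ∀ s, Integrable (D s) ν
  integrable_reward : ∀ s s', Integrable (fun a => D s a * (M.P s a s' * M.r s a s')) ν

theorem RewardIntegrable.integrableDensity {M : MDP S A} {π : Policy S A ν}
    (h : RewardIntegrable M π) : M.IntegrableDensity ν π.dens :=
  ⟨π.meas, π.integrable_dens, h⟩

theorem MDP.IntegrableDensity.integrable_P {M : MDP S A} {D : S → A → ℝ}
    (h : M.IntegrableDensity ν D) (s s' : S) : Integrable (fun a => D s a * M.P s a s') ν :=
  (h.integrable s).mul_bdd (c := 1) (M.P_meas s s').aestronglyMeasurable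
    (ae_of_all _ fun a => by
      rw [Real.norm_of_nonneg (M.P_nonneg _ _ _)]; exact M.P_le_one _ _ _)

theorem MDP.avgP_nonneg (M : MDP S A) (π : Policy S A ν) (s s' : S) :
    0 ≤ M.avgP ν π.dens s s' :=
  integral_nonneg fun a => mul_nonneg (π.nonneg s a) (M.P_nonneg s a s')

theorem MDP.sum_avgP (M : MDP S A) (π : Policy S A ν) (s : S) :
    ∑ s', M.avgP ν π.dens s s' = 1 := by
  simp only [MDP.avgP]
  rw [← integral_finsetSum]
  · simp only [← Finset.mul_sum, M.P_sum, mul_one, π.integral_dens]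
  · intro s' _
    simpa only [one_mul, mul_one] using ((Policy.IntegrableFn.const π 1).mul_P M s').integrable s

variable {M : MDP S A} {πb : Policy S A ν} {μ₀ : Measure S} {t : ℕ}
  {Z : (ℕ → S × A) → ℝ} {F : S → ℝ} {D : S → A → ℝ}

/-- The importance ratio cancels the behavior density. Allowing a signed `D` covers both the target
policy and its derivatives in the parameter. -/
theorem HasStateWeights.advance_div [IsProbabilityMeasure μ₀]
    (h : HasStateWeights M πb μ₀ t Z F) (hb : ∀ s a, 0 < πb.dens s a)
    (hD : M.IntegrableDensity ν D) :
    HasStateWeights M πb μ₀ (t + 1)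
      (fun x => Z x * (D (state t x) (action t x) / πb.dens (state t x) (action t x)))
      fun s' => ∑ s, F s * M.avgP ν D s s' := by
  have hu : πb.IntegrableFn fun s a => D s a / πb.dens s a :=
    ⟨fun s => (hD.measurable s).div (πb.meas s), fun s => by
      simpa only [mul_div_cancel₀ _ (hb s _).ne'] using hD.integrable s⟩
  have := h.advance hu
  simpa only [MDP.avgP, ← mul_assoc, mul_div_cancel₀ _ (hb _ _).ne'] using this

/-- The mean of the TD error weighted by `Z` and by the density ratio `D / π_b`. -/
theorem HasStateWeights.integral_tdError [IsProbabilityMeasure μ₀]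
    (h : HasStateWeights M πb μ₀ t Z F) (hb : ∀ s a, 0 < πb.dens s a)
    (hD : M.IntegrableDensity ν D) (γ : ℝ) {n : ℕ} (φ : S → Fin n → ℝ) (θ : Fin n → ℝ) :
    Integrable (fun x => Z x * (D (state t x) (action t x) / πb.dens (state t x) (action t x) *
      tdError M γ φ θ t x)) (trajLaw M πb μ₀) ∧
    ∫ x, Z x * (D (state t x) (action t x) / πb.dens (state t x) (action t x) *
      tdError M γ φ θ t x) ∂trajLaw M πb μ₀ =
      ∑ s, F s * (M.avgR ν D s + γ * ∑ s', M.avgP ν D s s' * (θ ⬝ᵥ φ s') -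
        (∑ s', M.avgP ν D s s') * (θ ⬝ᵥ φ s)) := by
  have e (s : S) (a : A) (s' : S) : πb.dens s a * (M.P s a s' * (D s a / πb.dens s a *
      (M.r s a s' + γ * (θ ⬝ᵥ φ s') - θ ⬝ᵥ φ s))) =
      D s a * (M.P s a s' * M.r s a s') + D s a * M.P s a s' * (γ * (θ ⬝ᵥ φ s') - θ ⬝ᵥ φ s) := by
    have := (hb s a).ne'
    field_simp
    ring
  have hi (s s' : S) := (hD.integrable_P s s').mul_const (γ * (θ ⬝ᵥ φ s') - θ ⬝ᵥ φ s)
  have key := h.transition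
    (r := fun s a s' => D s a / πb.dens s a * (M.r s a s' + γ * (θ ⬝ᵥ φ s') - θ ⬝ᵥ φ s))
    (fun s s' => ((hD.measurable s).div (πb.meas s)).mul
      (((M.r_meas s s').add_const _).sub_const _))
    (fun s s' => by
      simp only [e]
      exact (hD.integrable_reward s s').add (hi s s'))
  refine ⟨key.1, key.2.trans (Finset.sum_congr rfl fun s _ => ?_)⟩
  simp only [e]
  have hs (s' : S) : ∫ a, (D s a * (M.P s a s' * M.r s a s') +
      D s a * M.P s a s' * (γ * (θ ⬝ᵥ φ s') - θ ⬝ᵥ φ s)) ∂ν =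
      ∫ a, D s a * (M.P s a s' * M.r s a s') ∂ν +
        M.avgP ν D s s' * (γ * (θ ⬝ᵥ φ s') - θ ⬝ᵥ φ s) := by
    rw [integral_add (hD.integrable_reward s s') (hi s s'), integral_mul_const, MDP.avgP]
  simp only [hs]
  simp only [Finset.sum_add_distrib, mul_sub, Finset.sum_sub_distrib, MDP.avgR,
    ← Finset.sum_mul, mul_left_comm _ γ, ← Finset.mul_sum]
  ring

end Averages

/-! ### The value function as a Neumann series, and the Bellman equation. -/

section Value

variable {S A : Type*} [Fintype S] [MeasurableSpace S] [DiscreteMeasurableSpace S]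
  [MeasurableSpace A] {ν : Measure A} {M : MDP S A} {π : Policy S A ν} {γ : ℝ}

theorem hasStateWeights_pow [DecidableEq S] (M : MDP S A) (π : Policy S A ν) (s : S) (k : ℕ) :
    HasStateWeights M π (Measure.dirac s) k (fun _ => 1)
      ((Matrix.of (M.avgP ν π.dens) ^ k) s) := by
  induction k with
  | zero =>
    convert HasStateWeights.one (M := M) (πb := π) (μ₀ := Measure.dirac s) using 1
    funext s'
    by_cases h : s = s' <;> simp [Measure.real, h]
  | succ k ih =>
    have := ih.advance (Policy.IntegrableFn.const π 1)
    simp only [one_mul] at this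
    rw [pow_succ]
    exact this

/-- Expectation and series may be exchanged: the entries of each power of the transition matrix are
at most one, so the mean absolute reward at time `k` is bounded independently of `k`, and the
geometric series dominates. -/
theorem hasSum_value [DecidableEq S] (hγ0 : 0 ≤ γ) (hγ1 : γ < 1) (hr : RewardIntegrable M π)
    (s : S) :
    HasSum (fun k : ℕ => γ ^ k * ∑ s', (Matrix.of (M.avgP ν π.dens) ^ k) s s' *
      M.avgR ν π.dens s') (value M γ π s) := by
  set Q := Matrix.of (M.avgP ν π.dens) with hQ
  have hQ0 (k : ℕ) (s' : S) : 0 ≤ (Q ^ k) s s' := by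
    induction k generalizing s' with
    | zero => rw [pow_zero, Matrix.one_apply]; split_ifs <;> simp
    | succ k ih =>
      rw [pow_succ, Matrix.mul_apply]
      exact Finset.sum_nonneg fun s'' _ => mul_nonneg (ih s'') (M.avgP_nonneg π _ _)
  have hQ1 (k : ℕ) : ∑ s', (Q ^ k) s s' = 1 := by
    induction k with
    | zero => simp [Matrix.one_apply]
    | succ k ih =>
      simp only [pow_succ, Matrix.mul_apply]
      rw [Finset.sum_comm]
      simp only [← Finset.mul_sum, hQ, Matrix.of_apply, M.sum_avgP π, mul_one]
      exact ih
  have hQle (k : ℕ) (s' : S) : (Q ^ k) s s' ≤ 1 := by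
    rw [← hQ1 k]
    exact Finset.single_le_sum (fun i _ => hQ0 k i) (Finset.mem_univ s')
  have hrew (k : ℕ) := (hasStateWeights_pow M π s k).transition M.r_meas hr
  have habs (k : ℕ) := (hasStateWeights_pow M π s k).transition
    (r := fun s a s' => |M.r s a s'|) (fun s s' => (M.r_meas s s').abs) fun s s' => by
      have := (hr s s').abs
      simpa only [abs_mul, abs_of_nonneg (π.nonneg _ _), abs_of_nonneg (M.P_nonneg _ _ _)]
        using this
  simp only [one_mul] at hrew habs
  set R : S → ℝ := fun s => ∑ s', ∫ a, π.dens s a * (M.P s a s' * |M.r s a s'|) ∂ν with hR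
  have hR0 (s' : S) : 0 ≤ R s' := Finset.sum_nonneg fun _ _ => integral_nonneg fun a =>
    mul_nonneg (π.nonneg _ _) (mul_nonneg (M.P_nonneg _ _ _) (abs_nonneg _))
  have hsum : Summable fun k => ∫ x, ‖γ ^ k * reward M k x‖ ∂trajLaw M π (Measure.dirac s) := by
    refine Summable.of_nonneg_of_le (fun k => integral_nonneg fun _ => norm_nonneg _)
      (fun k => ?_) ((summable_geometric_of_lt_one hγ0 hγ1).mul_right (∑ s', R s'))
    simp only [norm_mul, norm_pow, Real.norm_eq_abs, abs_of_nonneg hγ0, integral_const_mul]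
    refine mul_le_mul_of_nonneg_left ?_ (pow_nonneg hγ0 k)
    refine (habs k).2.trans_le (Finset.sum_le_sum fun s' _ => ?_)
    exact mul_le_of_le_one_left (hR0 s') (hQle k s')
  have e : (fun k : ℕ => γ ^ k * ∑ s', (Q ^ k) s s' * M.avgR ν π.dens s') =
      fun k => ∫ x, γ ^ k * reward M k x ∂trajLaw M π (Measure.dirac s) := by
    funext k
    rw [integral_const_mul]
    exact congrArg _ (hrew k).2.symm
  rw [e]
  exact hasSum_integral_of_summable_integral_norm (fun k => (hrew k).1.const_mul (γ ^ k)) hsum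

/-- The Bellman equation. -/
theorem value_eq (hγ0 : 0 ≤ γ) (hγ1 : γ < 1) (hr : RewardIntegrable M π) (s : S) :
    value M γ π s =
      M.avgR ν π.dens s + γ * ∑ s', M.avgP ν π.dens s s' * value M γ π s' := by
  classical
  have h := hasSum_value hγ0 hγ1 hr
  -- Without its term `k = 0`, the series at `s` is `γ` times the average of the series at the next
  -- states, because `Q ^ (k + 1) = Q * Q ^ k`.
  have h1 := (hasSum_nat_add_iff' 1).2 (h s)
  have h2 := (hasSum_sum (s := Finset.univ) fun s' _ =>
    (h s').mul_left (M.avgP ν π.dens s s')).mul_left γ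
  have h3 : (fun k : ℕ => γ ^ (k + 1) * ∑ s', (Matrix.of (M.avgP ν π.dens) ^ (k + 1)) s s' *
      M.avgR ν π.dens s') = fun k => γ * ∑ s', M.avgP ν π.dens s s' * (γ ^ k *
        ∑ s'', (Matrix.of (M.avgP ν π.dens) ^ k) s' s'' * M.avgR ν π.dens s'') := by
    funext k
    simp only [pow_succ' (Matrix.of _), Matrix.mul_apply, Matrix.of_apply, Finset.mul_sum,
      Finset.sum_mul]
    rw [Finset.sum_comm]
    exact Finset.sum_congr rfl fun _ _ => Finset.sum_congr rfl fun _ _ => by ring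
  rw [h3] at h1
  have h4 := h1.unique h2
  simp [Matrix.one_apply] at h4
  linarith

end Value

/-! ### State weights of the eligibility traces, and the identity `J = d V`. -/

section Traces

variable {S A : Type*} [Fintype S] [MeasurableSpace S] [DiscreteMeasurableSpace S]
  [MeasurableSpace A] {ν : Measure A} {M : MDP S A} {πb π : Policy S A ν} {μ₀ : Measure S}
  [IsProbabilityMeasure μ₀] {γ : ℝ}

theorem hasStateWeights_one (t : ℕ) :
    HasStateWeights M πb μ₀ t (fun _ => 1)
      fun s => (trajLaw M πb μ₀).real {x | state t x = s} := by
  classical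
  have hex : ∃ F, HasStateWeights M πb μ₀ t (fun _ => 1) F := by
    induction t with
    | zero => exact ⟨_, .one⟩
    | succ t ih =>
      obtain ⟨F, hF⟩ := ih
      have := hF.advance (Policy.IntegrableFn.const πb 1)
      simp only [one_mul] at this
      exact ⟨_, this⟩
  obtain ⟨F, hF⟩ := hex
  convert hF using 1
  funext s
  -- Testing against the indicator of `s` identifies the weights with the law of `s_t`.
  have h := hF.integral ((Policy.IntegrableFn.const πb 1).mul_state
    fun s' => if s' = s then 1 else 0)
  simp only [one_mul, integral_mul_const, πb.integral_dens] at h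
  have hm : MeasurableSet {x : ℕ → S × A | state t x = s} :=
    (measurable_fst.comp (measurable_pi_apply t)) (measurableSet_singleton s)
  have hind : (fun x : ℕ → S × A => if state t x = s then (1 : ℝ) else 0) =
      {x | state t x = s}.indicator 1 := by
    funext x; simp [Set.indicator_apply]
  rw [hind, integral_indicator_one hm] at h
  rw [h]
  simp

/-- Common form of all the traces: a source plus `γ ρ_t` times the previous value. Under the ratio,
the weights move by the transition matrix of the target policy. -/
theorem exists_hasStateWeights_of_recursion (hb : ∀ s a, 0 < πb.dens s a)
    (hr : RewardIntegrable M π) {Z C : ℕ → (ℕ → S × A) → ℝ} {c : ℕ → S → ℝ} (h0 : Z 0 = C 0)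
    (hZ : ∀ t x, Z (t + 1) x = C (t + 1) x + γ * (Z t x * rho πb π t x))
    (hC : ∀ t, HasStateWeights M πb μ₀ t (C t) (c t)) :
    ∃ F : ℕ → S → ℝ, (∀ t, HasStateWeights M πb μ₀ t (Z t) (F t)) ∧
      ∀ t s', F (t + 1) s' = c (t + 1) s' + γ * ∑ s, F t s * M.avgP ν π.dens s s' := by
  let F : ℕ → S → ℝ := fun t => Nat.rec (c 0)
    (fun t f s' => c (t + 1) s' + γ * ∑ s, f s * M.avgP ν π.dens s s') t
  refine ⟨F, fun t => ?_, fun _ _ => rfl⟩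
  induction t with
  | zero => rw [h0]; exact hC 0
  | succ t ih =>
    have h := (hC (t + 1)).add
      ((ih.advance_div hb hr.integrableDensity).mul_state fun _ => γ)
    convert h using 1
    · funext x
      rw [hZ, mul_comm γ]
      rfl
    · funext s'
      rw [mul_comm _ γ]

theorem exists_hasStateWeights_eTrace (hb : ∀ s a, 0 < πb.dens s a) (hr : RewardIntegrable M π)
    {n : ℕ} (φ : S → Fin n → ℝ) (i : Fin n) :
    ∃ F : ℕ → S → ℝ, (∀ t, HasStateWeights M πb μ₀ t (fun x => eTrace γ πb π φ t x i) (F t)) ∧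
      ∀ t s', F (t + 1) s' = (trajLaw M πb μ₀).real {x | state (t + 1) x = s'} * φ s' i +
        γ * ∑ s, F t s * M.avgP ν π.dens s s' := by
  refine exists_hasStateWeights_of_recursion hb hr (C := fun t x => φ (state t x) i)
    (c := fun t s => (trajLaw M πb μ₀).real {x | state t x = s} * φ s i) rfl (fun t x => ?_)
    fun t => ?_
  · simp only [eTrace, Pi.add_apply, Pi.smul_apply, smul_eq_mul]
    ring
  · simpa only [one_mul] using (hasStateWeights_one t).mul_state fun s => φ s i

theorem exists_hasStateWeights_fTrace (hb : ∀ s a, 0 < πb.dens s a)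
    (hr : RewardIntegrable M π) :
    ∃ F : ℕ → S → ℝ, (∀ t, HasStateWeights M πb μ₀ t (fTrace γ πb π t) (F t)) ∧
      ∀ t s', F (t + 1) s' = (trajLaw M πb μ₀).real {x | state (t + 1) x = s'} +
        γ * ∑ s, F t s * M.avgP ν π.dens s s' := by
  refine exists_hasStateWeights_of_recursion hb hr (C := fun _ _ => 1)
    (c := fun t s => (trajLaw M πb μ₀).real {x | state t x = s}) rfl (fun t x => ?_)
    fun t => hasStateWeights_one t
  simp only [fTrace]
  ring

variable {n : ℕ} {φ : S → Fin n → ℝ} {θ : Fin n → ℝ} {d : S → ℝ} {i₀ : Fin n}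

/-- The mean TD error as a Bellman residual of the value error. -/
theorem avgR_add_sub_eq (hγ0 : 0 ≤ γ) (hγ1 : γ < 1) (hr : RewardIntegrable M π) (s : S) :
    M.avgR ν π.dens s + γ * ∑ s', M.avgP ν π.dens s s' * (θ ⬝ᵥ φ s') -
        (∑ s', M.avgP ν π.dens s s') * (θ ⬝ᵥ φ s) =
      (value M γ π s - θ ⬝ᵥ φ s) -
        γ * ∑ s', M.avgP ν π.dens s s' * (value M γ π s' - θ ⬝ᵥ φ s') := by
  rw [value_eq hγ0 hγ1 hr s, M.sum_avgP π]
  simp only [mul_sub, Finset.sum_sub_distrib]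
  ring

/-- The coordinate `i₀` of `e_t` obeys the recursion of `f_t`, so its weights tend to `d (1 - γ
P)⁻¹`. The mean TD error is `1 - γ P` applied to the value error; the two factors cancel and leave
the `d`-average of the error. -/
theorem IsGTD1Solution.sum_mul_value_sub (hγ0 : 0 ≤ γ) (hγ1 : γ < 1)
    (hb : ∀ s a, 0 < πb.dens s a) (hr : RewardIntegrable M π) (hd : IsSteadyState M πb μ₀ d)
    (hφ : ∀ s, φ s i₀ = 1) (hθ : IsGTD1Solution M γ πb π μ₀ φ θ) :
    ∑ s, d s * (value M γ π s - θ ⬝ᵥ φ s) = 0 := by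
  -- All coordinates are needed to evaluate the vector integral at `i₀`: it is zero by default if
  -- the vector is not integrable.
  have hint (t : ℕ) (i : Fin n) : Integrable (fun x => ((rho πb π t x * tdError M γ φ θ t x) •
      eTrace γ πb π φ t x) i) (trajLaw M πb μ₀) := by
    obtain ⟨F, hF, -⟩ := exists_hasStateWeights_eTrace (μ₀ := μ₀) (γ := γ) hb hr φ i
    refine ((hF t).integral_tdError hb hr.integrableDensity γ φ θ).1.congr
      (ae_of_all _ fun x => ?_)
    exact mul_comm _ _
  obtain ⟨F, hF, hrec⟩ := exists_hasStateWeights_eTrace (μ₀ := μ₀) (γ := γ) hb hr φ i₀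
  simp only [hφ, mul_one] at hrec
  obtain ⟨f, hlim, hf⟩ := exists_tendsto_of_discounted_recursion hγ0 hγ1 (M.avgP_nonneg π)
    (M.sum_avgP π) hd.tendsto hrec
  have h1 := (continuous_apply i₀).tendsto _ |>.comp hθ
  have h2 : (fun t => (∫ x, (rho πb π t x * tdError M γ φ θ t x) • eTrace γ πb π φ t x
      ∂trajLaw M πb μ₀) i₀) = fun t => ∑ s, F t s * ((value M γ π s - θ ⬝ᵥ φ s) -
        γ * ∑ s', M.avgP ν π.dens s s' * (value M γ π s' - θ ⬝ᵥ φ s')) := by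
    funext t
    rw [eval_integral (hint t)]
    have := ((hF t).integral_tdError hb hr.integrableDensity γ φ θ).2
    simp only [avgR_add_sub_eq hγ0 hγ1 hr] at this
    rw [← this]
    refine integral_congr_ae (ae_of_all _ fun x => ?_)
    exact mul_comm _ _
  have h3 : Tendsto (fun t => ∑ s, F t s * ((value M γ π s - θ ⬝ᵥ φ s) -
      γ * ∑ s', M.avgP ν π.dens s s' * (value M γ π s' - θ ⬝ᵥ φ s'))) atTop (𝓝 0) := by
    rw [← h2]
    exact h1
  have h4 := tendsto_nhds_unique h3 (tendsto_finsetSum _ fun s _ => (hlim s).mul_const _)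
  rw [h4, sum_mul_sub_discounted hf]

/-- Moving `θ` by the mean error `m` along the constant feature lowers the mean-square error by `m ^
2`, so minimality forces `m = 0`. -/
theorem IsMSESolution.sum_mul_value_sub (hd : ∑ s, d s = 1) (hφ : ∀ s, φ s i₀ = 1)
    (hθ : IsMSESolution M γ π d φ θ) : ∑ s, d s * (value M γ π s - θ ⬝ᵥ φ s) = 0 := by
  set m := ∑ s, d s * (value M γ π s - θ ⬝ᵥ φ s) with hm
  have h := hθ (θ + Pi.single i₀ m)
  have h1 : mse M γ π d φ (θ + Pi.single i₀ m) = mse M γ π d φ θ - m ^ 2 := by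
    have e (s : S) : d s * (value M γ π s - (θ + Pi.single i₀ m) ⬝ᵥ φ s) ^ 2 =
        d s * (value M γ π s - θ ⬝ᵥ φ s) ^ 2 - 2 * m * (d s * (value M γ π s - θ ⬝ᵥ φ s)) +
          d s * m ^ 2 := by
      rw [add_dotProduct, single_dotProduct, hφ]
      ring
    simp only [mse, e, Finset.sum_add_distrib, Finset.sum_sub_distrib, ← Finset.mul_sum,
      ← Finset.sum_mul, hd, ← hm]
    ring
  rw [h1] at h
  exact pow_eq_zero_iff two_ne_zero |>.1 (le_antisymm (by linarith) (sq_nonneg m))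

end Traces

/-! ### Differentiating action averages in the policy parameter. -/

section PolicyDerivatives

variable {S A : Type*} [Fintype S] [MeasurableSpace S] [DiscreteMeasurableSpace S]
  [MeasurableSpace A] {ν : Measure A} {K : ℕ} {M : MDP S A}
  {π : EuclideanSpace ℝ (Fin K) → Policy S A ν} {w : EuclideanSpace ℝ (Fin K)}

/-- The derivative of `v ↦ π_v(a | s)` at `w` in the direction `e`. -/
noncomputable def densDeriv (π : EuclideanSpace ℝ (Fin K) → Policy S A ν)
    (w e : EuclideanSpace ℝ (Fin K)) (s : S) (a : A) : ℝ :=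
  fderiv ℝ (fun v => (π v).dens s a) w e

/-- A pointwise limit of difference quotients with step `1 / m`, each measurable in the action. -/
theorem PolicyRegularAt.measurable_densDeriv (hw : PolicyRegularAt M π w)
    (e : EuclideanSpace ℝ (Fin K)) (s : S) : Measurable (densDeriv π w e s) := by
  refine measurable_of_tendsto_metrizable
    (f := fun (m : ℕ) a => (m : ℝ) • ((π (w + (m : ℝ)⁻¹ • e)).dens s a - (π w).dens s a))
    (fun m => ((((π (w + (m : ℝ)⁻¹ • e)).meas s).sub ((π w).meas s)).const_smul (m : ℝ) :))
    (tendsto_pi_nhds.2 fun a => ?_)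
  exact ((hw.diff s a).hasFDerivAt.lim_real e).comp tendsto_natCast_atTop_atTop

theorem PolicyRegularAt.measurable_fderiv (hw : PolicyRegularAt M π w) (s : S) :
    StronglyMeasurable fun a => fderiv ℝ (fun v => (π v).dens s a) w := by
  have h : (fun a => fderiv ℝ (fun v => (π v).dens s a) w) = fun a => ∑ k,
      densDeriv π w (EuclideanSpace.single k 1) s a •
        (EuclideanSpace.proj k : EuclideanSpace ℝ (Fin K) →L[ℝ] ℝ) := by
    funext a
    refine ContinuousLinearMap.coe_injective
      ((EuclideanSpace.basisFun (Fin K) ℝ).toBasis.ext fun i => ?_)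
    simp [densDeriv]
  rw [h]
  exact Finset.stronglyMeasurable_fun_sum _ fun k _ =>
    (hw.measurable_densDeriv _ s).stronglyMeasurable.smul_const _

/-- Differentiation under the integral over the actions. -/
theorem PolicyRegularAt.hasFDerivAt_integral {g : A → ℝ} {ε : ℝ} {s : S} {c : A → ℝ}
    (hw : PolicyRegularAt M π w) (hε : 0 < ε)
    (hg : ∀ a v, ‖v - w‖ < ε → |(π v).dens s a - (π w).dens s a| ≤ g a * ‖v - w‖)
    (hc : Measurable c) (hgc : Integrable (fun a => g a * c a) ν)
    (hwc : Integrable (fun a => (π w).dens s a * c a) ν) :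
    DifferentiableAt ℝ (fun v => ∫ a, (π v).dens s a * c a ∂ν) w ∧
    ∀ e, Integrable (fun a => densDeriv π w e s a * c a) ν ∧
      fderiv ℝ (fun v => ∫ a, (π v).dens s a * c a ∂ν) w e =
        ∫ a, densDeriv π w e s a * c a ∂ν := by
  have key := hasFDerivAt_integral_of_dominated_loc_of_lip' (𝕜 := ℝ) (μ := ν)
    (F := fun v a => (π v).dens s a * c a)
    (F' := fun a => c a • fderiv ℝ (fun v => (π v).dens s a) w)
    (bound := fun a => |g a * c a|) (Metric.ball_mem_nhds w hε)
    (fun v _ => (((π v).meas s).mul hc).aestronglyMeasurable) hwc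
    (hc.stronglyMeasurable.smul (hw.measurable_fderiv s)).aestronglyMeasurable
    (ae_of_all _ fun a v hv => ?_) hgc.abs
    (ae_of_all _ fun a => (hw.diff s a).hasFDerivAt.mul_const (c a))
  · refine ⟨key.2.differentiableAt, fun e => ⟨?_, ?_⟩⟩
    · refine (key.1.apply_continuousLinearMap e).congr (ae_of_all _ fun a => ?_)
      simp [densDeriv, mul_comm]
    · rw [key.2.fderiv, ContinuousLinearMap.integral_apply key.1]
      simp [densDeriv, mul_comm]
  · rw [← sub_mul, norm_mul, abs_mul, Real.norm_eq_abs, Real.norm_eq_abs, mul_right_comm]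
    refine mul_le_mul_of_nonneg_right ?_ (abs_nonneg _)
    refine (hg a v (by rwa [← dist_eq_norm])).trans ?_
    exact mul_le_mul_of_nonneg_right (le_abs_self _) (norm_nonneg _)

theorem PolicyRegularAt.integrableDensity (hw : PolicyRegularAt M π w)
    (hr : RewardIntegrable M (π w)) (e : EuclideanSpace ℝ (Fin K)) :
    M.IntegrableDensity ν (densDeriv π w e) := by
  obtain ⟨ε, hε, g, hg, hgr, hle⟩ := hw.dominated
  refine ⟨hw.measurable_densDeriv e, fun s => ?_, fun s s' => ?_⟩
  · simpa using ((hw.hasFDerivAt_integral hε (hle s) (c := fun _ => 1) measurable_const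
      (by simpa using hg s) (by simpa using (π w).integrable_dens s)).2 e).1
  · exact ((hw.hasFDerivAt_integral hε (hle s) ((M.P_meas s s').mul (M.r_meas s s'))
      (hgr s s') (hr s s')).2 e).1

theorem PolicyRegularAt.avgP (hw : PolicyRegularAt M π w) (hr : RewardIntegrable M (π w))
    (s s' : S) : DifferentiableAt ℝ (fun v => M.avgP ν (π v).dens s s') w ∧
      ∀ e, fderiv ℝ (fun v => M.avgP ν (π v).dens s s') w e =
        M.avgP ν (densDeriv π w e) s s' := by
  obtain ⟨ε, hε, g, hg, hgr, hle⟩ := hw.dominated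
  have hgP : Integrable (fun a => g s a * M.P s a s') ν :=
    (hg s).mul_bdd (c := 1) (M.P_meas s s').aestronglyMeasurable
      (ae_of_all _ fun a => by
        rw [Real.norm_of_nonneg (M.P_nonneg _ _ _)]; exact M.P_le_one _ _ _)
  have h := hw.hasFDerivAt_integral hε (hle s) (M.P_meas s s') hgP
    (hr.integrableDensity.integrable_P s s')
  exact ⟨h.1, fun e => (h.2 e).2⟩

theorem PolicyRegularAt.avgR (hw : PolicyRegularAt M π w) (hr : RewardIntegrable M (π w))
    (s : S) : DifferentiableAt ℝ (fun v => M.avgR ν (π v).dens s) w ∧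
      ∀ e, fderiv ℝ (fun v => M.avgR ν (π v).dens s) w e =
        M.avgR ν (densDeriv π w e) s := by
  obtain ⟨ε, hε, g, hg, hgr, hle⟩ := hw.dominated
  have h (s' : S) := hw.hasFDerivAt_integral hε (hle s)
    (c := fun a => M.P s a s' * M.r s a s') ((M.P_meas s s').mul (M.r_meas s s'))
    (hgr s s') (hr s s')
  refine ⟨.fun_sum fun s' _ => (h s').1, fun e => ?_⟩
  simp only [MDP.avgR]
  rw [fderiv_fun_sum fun s' _ => (h s').1, sum_apply]
  exact Finset.sum_congr rfl fun s' _ => ((h s').2 e).2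

/-- Derivative of the constant total probability; it removes the `θᵀφ(s_t)` part of the TD error
from the score term. -/
theorem PolicyRegularAt.sum_avgP_densDeriv (hw : PolicyRegularAt M π w)
    (hr : RewardIntegrable M (π w)) (e : EuclideanSpace ℝ (Fin K)) (s : S) :
    ∑ s', M.avgP ν (densDeriv π w e) s s' = 0 := by
  have h : fderiv ℝ (fun v => ∑ s', M.avgP ν (π v).dens s s') w e = 0 := by
    simp only [M.sum_avgP, fderiv_fun_const, Pi.zero_apply, zero_apply]
  rw [fderiv_fun_sum fun s' _ => (hw.avgP hr s s').1, sum_apply] at h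
  simpa only [(hw.avgP hr s _).2] using h

end PolicyDerivatives

/-! ### Differentiability of the value function. -/

section ValueDerivative

/-- By Cramer's rule `V` is a quotient of determinants in the entries of `P` and `R`, with
nonvanishing denominator. This has to precede differentiating the Bellman equation itself. -/
theorem differentiableAt_of_bellman {S E : Type*} [Fintype S] [NormedAddCommGroup E]
    [NormedSpace ℝ E] {γ : ℝ} (hγ0 : 0 ≤ γ) (hγ1 : γ < 1) {P : E → S → S → ℝ} {R V : E → S → ℝ}
    {w : E} (hP0 : ∀ v s s', 0 ≤ P v s s') (hP1 : ∀ v s, ∑ s', P v s s' = 1)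
    (hV : ∀ v s, V v s = R v s + γ * ∑ s', P v s s' * V v s')
    (hP : ∀ s s', DifferentiableAt ℝ (fun v => P v s s') w)
    (hR : ∀ s, DifferentiableAt ℝ (fun v => R v s) w) (s : S) :
    DifferentiableAt ℝ (fun v => V v s) w := by
  classical
  let B : E → Matrix S S ℝ := fun v => 1 - γ • Matrix.of (P v)
  have hB (v : E) : (B v).det ≠ 0 := det_one_sub_smul_ne_zero hγ0 hγ1 (hP0 v) (hP1 v)
  have hBV (v : E) : (B v).mulVec (V v) = R v := by
    funext s
    simp only [B, Matrix.sub_mulVec, Matrix.one_mulVec, Matrix.smul_mulVec, Pi.sub_apply,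
      Pi.smul_apply, smul_eq_mul]
    rw [hV v s]
    simp [Matrix.mulVec, dotProduct]
  have hcramer : (fun v => V v s) = fun v => ((B v).det)⁻¹ * ((B v).updateCol s (R v)).det := by
    funext v
    rw [← Matrix.cramer_apply, Matrix.cramer_eq_adjugate_mulVec, ← hBV v, Matrix.mulVec_mulVec,
      Matrix.adjugate_mul, Matrix.smul_mulVec, Matrix.one_mulVec, Pi.smul_apply, smul_eq_mul,
      inv_mul_cancel_left₀ (hB v)]
  have hdet {C : E → Matrix S S ℝ} (hC : ∀ i j, DifferentiableAt ℝ (fun v => C v i j) w) :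
      DifferentiableAt ℝ (fun v => (C v).det) w := by
    simp only [Matrix.det_apply']
    exact .fun_sum fun σ _ => (HasFDerivAt.finsetProd (u := Finset.univ) fun i _ =>
      (hC (σ i) i).hasFDerivAt).differentiableAt.const_mul _
  have hBd (i j : S) : DifferentiableAt ℝ (fun v => B v i j) w := by
    simp only [B, Matrix.sub_apply, Matrix.smul_apply, Matrix.of_apply, smul_eq_mul]
    exact ((hP i j).const_mul γ).const_sub _
  rw [hcramer]
  refine ((hdet hBd).inv (hB w)).mul (hdet fun i j => ?_)
  simp only [Matrix.updateCol_apply]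
  split_ifs
  · exact hR i
  · exact hBd i j

variable {S A : Type*} [Fintype S] [MeasurableSpace S] [DiscreteMeasurableSpace S]
  [MeasurableSpace A] {ν : Measure A} {K : ℕ} {M : MDP S A} {γ : ℝ}
  {π : EuclideanSpace ℝ (Fin K) → Policy S A ν} {w : EuclideanSpace ℝ (Fin K)}

theorem PolicyRegularAt.differentiableAt_value (hγ0 : 0 ≤ γ) (hγ1 : γ < 1)
    (hr : ∀ v, RewardIntegrable M (π v)) (hw : PolicyRegularAt M π w) (s : S) :
    DifferentiableAt ℝ (fun v => value M γ (π v) s) w :=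
  differentiableAt_of_bellman hγ0 hγ1 (fun v => M.avgP_nonneg (π v)) (fun v => M.sum_avgP (π v))
    (fun v s => value_eq hγ0 hγ1 (hr v) s) (fun s s' => (hw.avgP (hr w) s s').1)
    (fun s => (hw.avgR (hr w) s).1) s

/-- The Bellman equation for the derivative of the value function. -/
theorem PolicyRegularAt.fderiv_value (hγ0 : 0 ≤ γ) (hγ1 : γ < 1)
    (hr : ∀ v, RewardIntegrable M (π v)) (hw : PolicyRegularAt M π w)
    (e : EuclideanSpace ℝ (Fin K)) (s : S) :
    fderiv ℝ (fun v => value M γ (π v) s) w e =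
      M.avgR ν (densDeriv π w e) s +
        γ * ∑ s', M.avgP ν (densDeriv π w e) s s' * value M γ (π w) s' +
        γ * ∑ s', M.avgP ν (π w).dens s s' * fderiv ℝ (fun v => value M γ (π v) s') w e := by
  have hV := hw.differentiableAt_value hγ0 hγ1 hr
  have h := ((hw.avgR (hr w) s).1.hasFDerivAt.add ((HasFDerivAt.fun_sum (u := Finset.univ)
    fun s' _ => (hw.avgP (hr w) s s').1.hasFDerivAt.mul (hV s').hasFDerivAt).const_mul γ)).fderiv
  have e1 : (fun v => value M γ (π v) s) = (fun v => M.avgR ν (π v).dens s) +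
      fun v => γ * ∑ s', M.avgP ν (π v).dens s s' * value M γ (π v) s' := by
    funext v
    exact value_eq hγ0 hγ1 (hr v) s
  conv_lhs => rw [e1]
  refine (DFunLike.congr_fun h e).trans ?_
  simp [(hw.avgR (hr w) s).2, (hw.avgP (hr w) s _).2, Finset.sum_add_distrib]
  simp only [mul_comm (value M γ (π w) _)]
  ring

end ValueDerivative

/-! ### The score and the weights of the gradient trace. -/

section Gradient

variable {S A : Type*} [Fintype S] [MeasurableSpace S] [DiscreteMeasurableSpace S]
  [MeasurableSpace A] {ν : Measure A} {K : ℕ} {M : MDP S A} {γ : ℝ} {πb : Policy S A ν}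
  {π : EuclideanSpace ℝ (Fin K) → Policy S A ν} {w : EuclideanSpace ℝ (Fin K)}
  {μ₀ : Measure S}

theorem gradient_apply (f : EuclideanSpace ℝ (Fin K) → ℝ) (w : EuclideanSpace ℝ (Fin K))
    (k : Fin K) : ∇ f w k = fderiv ℝ f w (EuclideanSpace.single k 1) := by
  rw [← inner_gradient_left, EuclideanSpace.inner_single_right]
  simp

/-- The log-derivative trick: `π ∇ log π = ∇ π`. -/
theorem PolicyRegularAt.rho_mul_score (hw : PolicyRegularAt M π w) (k : Fin K) (t : ℕ)
    (x : ℕ → S × A) :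
    rho πb (π w) t x * score π w (state t x) (action t x) k =
      densDeriv π w (EuclideanSpace.single k 1) (state t x) (action t x) /
        πb.dens (state t x) (action t x) := by
  have hpos := (hw.pos (state t x) (action t x)).ne'
  rw [score, gradient_apply, fderiv.log (hw.diff _ _) hpos, rho]
  simp only [densDeriv, FunLike.coe_smul, Pi.smul_apply, smul_eq_mul]
  field_simp

/-- The part `ρ_{t-1} ψ_{t-1}` of the `k`-th coordinate of `ψ_t` that does not depend on `a_t`. -/
noncomputable def psiTail (γ : ℝ) (πb : Policy S A ν)
    (π : EuclideanSpace ℝ (Fin K) → Policy S A ν) (w : EuclideanSpace ℝ (Fin K)) (k : Fin K) :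
    ℕ → (ℕ → S × A) → ℝ
  | 0, _ => 0
  | t + 1, x => rho πb (π w) t x * psiTrace γ πb π w t x k

theorem psiTrace_apply (t : ℕ) (x : ℕ → S × A) (k : Fin K) :
    psiTrace γ πb π w t x k =
      fTrace γ πb (π w) t x * score π w (state t x) (action t x) k +
        γ * psiTail γ πb π w k t x := by
  cases t with
  | zero => simp [psiTrace, psiTail]
  | succ t => simp [psiTrace, psiTail, mul_assoc]

/-- The trace `ψ_t` contains the score at `a_t`, so the weights are attached to its tail.
Multiplying `ψ_t` by `ρ_t` turns the score term into the source `f_t ∂π / π_b`. -/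
theorem exists_hasStateWeights_psiTail [IsProbabilityMeasure μ₀]
    (hb : ∀ s a, 0 < πb.dens s a) (hr : RewardIntegrable M (π w)) (hw : PolicyRegularAt M π w)
    (k : Fin K) {F : ℕ → S → ℝ}
    (hF : ∀ t, HasStateWeights M πb μ₀ t (fTrace γ πb (π w) t) (F t)) :
    ∃ G : ℕ → S → ℝ, (∀ t, HasStateWeights M πb μ₀ t (psiTail γ πb π w k t) (G t)) ∧
      ∀ t s', G (t + 1) s' =
        ∑ s, F t s * M.avgP ν (densDeriv π w (EuclideanSpace.single k 1)) s s' +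
          γ * ∑ s, G t s * M.avgP ν (π w).dens s s' := by
  let D := densDeriv π w (EuclideanSpace.single k 1)
  refine exists_hasStateWeights_of_recursion (μ₀ := μ₀) (γ := γ) hb hr
    (Z := psiTail γ πb π w k)
    -- The source at time `t + 1` is built from `f_t`; at time `0` it vanishes.
    (C := fun t => Nat.casesOn t (fun _ => 0) fun t x => fTrace γ πb (π w) t x *
      (D (state t x) (action t x) / πb.dens (state t x) (action t x)))
    (c := fun t => Nat.casesOn t (fun _ => 0) fun t s' => ∑ s, F t s * M.avgP ν D s s') rfl
    (fun t x => ?_) fun t => ?_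
  · rw [psiTail, psiTrace_apply]
    change _ = fTrace γ πb (π w) t x *
      (D (state t x) (action t x) / πb.dens (state t x) (action t x)) + _
    rw [← hw.rho_mul_score]
    ring
  · cases t with
    | zero => simpa using (HasStateWeights.one (M := M) (πb := πb) (μ₀ := μ₀)).mul_state 0
    | succ t => exact (hF t).advance_div hb (hw.integrableDensity hr _)

end Gradient

end RL

/-! ### The gradient formula. -/

theorem theorem2 {S A : Type*} [Fintype S] [MeasurableSpace S] [DiscreteMeasurableSpace S]
    [MeasurableSpace A] {ν : Measure A} {K n : ℕ}
    (M : RL.MDP S A) (γ : ℝ) (hγ0 : 0 ≤ γ) (hγ1 : γ < 1)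
    (πb : RL.Policy S A ν) (hb : ∀ s a, 0 < πb.dens s a)
    (π : EuclideanSpace ℝ (Fin K) → RL.Policy S A ν)
    (hr : ∀ v, RL.RewardIntegrable M (π v))
    (μ₀ : Measure S) [IsProbabilityMeasure μ₀]
    (d : S → ℝ) (hd : RL.IsSteadyState M πb μ₀ d)
    (φ : S → Fin n → ℝ) (i₀ : Fin n) (hφ : ∀ s, φ s i₀ = 1)
    (θ : EuclideanSpace ℝ (Fin K) → Fin n → ℝ)
    (hθ : ∀ v, RL.IsGTD1Solution M γ πb (π v) μ₀ φ (θ v) ∨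
      RL.IsMSESolution M γ (π v) d φ (θ v))
    (w : EuclideanSpace ℝ (Fin K)) (hw : RL.PolicyRegularAt M π w) :
    DifferentiableAt ℝ (RL.objective d φ θ) w ∧
    (∀ t, Integrable (fun x => (RL.rho πb (π w) t x * RL.tdError M γ φ (θ w) t x) •
      RL.psiTrace γ πb π w t x) (RL.trajLaw M πb μ₀)) ∧
    Tendsto (fun t => ∫ x, (RL.rho πb (π w) t x * RL.tdError M γ φ (θ w) t x) •
      RL.psiTrace γ πb π w t x ∂(RL.trajLaw M πb μ₀)) atTop (𝓝 (∇ (RL.objective d φ θ) w)) := by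
  have hobj : RL.objective d φ θ = fun v => ∑ s, d s * RL.value M γ (π v) s := by
    funext v
    have h : ∑ s, d s * (RL.value M γ (π v) s - θ v ⬝ᵥ φ s) = 0 := (hθ v).elim
      (fun h => h.sum_mul_value_sub hγ0 hγ1 hb (hr v) hd hφ)
      (fun h => h.sum_mul_value_sub hd.sum_eq_one hφ)
    simp only [mul_sub, Finset.sum_sub_distrib] at h
    rw [sub_eq_zero.1 h, RL.objective, dotProduct_sum]
    simp only [dotProduct_smul, smul_eq_mul]
  have hV := hw.differentiableAt_value hγ0 hγ1 hr
  have hdiff : DifferentiableAt ℝ (RL.objective d φ θ) w := by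
    rw [hobj]
    exact .fun_sum fun s _ => (hV s).const_mul _
  obtain ⟨F, hF, hFrec⟩ := RL.exists_hasStateWeights_fTrace (μ₀ := μ₀) (γ := γ) hb (hr w)
  obtain ⟨f, hFlim, hf⟩ := RL.exists_tendsto_of_discounted_recursion hγ0 hγ1
    (M.avgP_nonneg (π w)) (M.sum_avgP (π w)) hd.tendsto hFrec
  -- The score term weights the TD error by `∂π / π_b`, the tail by `π_w / π_b`, so the mean TD
  -- error formula applies to each.
  have hcoord (t : ℕ) (k : Fin K) (x : ℕ → S × A) :
      ((RL.rho πb (π w) t x * RL.tdError M γ φ (θ w) t x) • RL.psiTrace γ πb π w t x) k =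
      RL.fTrace γ πb (π w) t x *
        (RL.densDeriv π w (EuclideanSpace.single k 1) (RL.state t x) (RL.action t x) /
          πb.dens (RL.state t x) (RL.action t x) * RL.tdError M γ φ (θ w) t x) +
      γ * (RL.psiTail γ πb π w k t x * ((π w).dens (RL.state t x) (RL.action t x) /
          πb.dens (RL.state t x) (RL.action t x) * RL.tdError M γ φ (θ w) t x)) := by
    rw [PiLp.smul_apply, smul_eq_mul, RL.psiTrace_apply, ← hw.rho_mul_score, ← RL.rho]
    ring
  have hF' (t : ℕ) (k : Fin K) := (hF t).integral_tdError hb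
    (hw.integrableDensity (hr w) (EuclideanSpace.single k 1)) γ φ (θ w)
  have hG' (t : ℕ) (k : Fin K) {G : S → ℝ}
      (hG : RL.HasStateWeights M πb μ₀ t (RL.psiTail γ πb π w k t) G) :=
    hG.integral_tdError hb (hr w).integrableDensity γ φ (θ w)
  have hint (t : ℕ) (k : Fin K) : Integrable (fun x => ((RL.rho πb (π w) t x *
      RL.tdError M γ φ (θ w) t x) • RL.psiTrace γ πb π w t x) k) (RL.trajLaw M πb μ₀) := by
    obtain ⟨G, hG, -⟩ := RL.exists_hasStateWeights_psiTail hb (hr w) hw k hF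
    simp only [hcoord]
    exact (hF' t k).1.add ((hG' t k (hG t)).1.const_mul γ)
  refine ⟨hdiff, fun t => Integrable.of_eval_piLp (hint t), ?_⟩
  have hpi : Tendsto (fun t => WithLp.ofLp (∫ x, (RL.rho πb (π w) t x *
      RL.tdError M γ φ (θ w) t x) • RL.psiTrace γ πb π w t x ∂(RL.trajLaw M πb μ₀))) atTop
      (𝓝 (WithLp.ofLp (∇ (RL.objective d φ θ) w))) := by
    refine tendsto_pi_nhds.2 fun k => ?_
    obtain ⟨G, hG, hGrec⟩ := RL.exists_hasStateWeights_psiTail hb (hr w) hw k hF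
    set D := RL.densDeriv π w (EuclideanSpace.single k 1)
    obtain ⟨g, hGlim, hg⟩ := RL.exists_tendsto_of_discounted_recursion hγ0 hγ1
      (M.avgP_nonneg (π w)) (M.sum_avgP (π w))
      -- The source lags by one step; its value at `t = 0`, where `t - 1` is truncated, does not
      -- enter the recursion.
      (C := fun t s' => ∑ s, F (t - 1) s * M.avgP ν D s s')
      (c := fun s' => ∑ s, f s * M.avgP ν D s s')
      (fun s' => tendsto_finsetSum _ fun s _ =>
        ((tendsto_add_atTop_iff_nat 1).1 (by simpa using hFlim s)).mul_const _) hGrec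
    have hval (t : ℕ) : (∫ x, (RL.rho πb (π w) t x * RL.tdError M γ φ (θ w) t x) •
        RL.psiTrace γ πb π w t x ∂(RL.trajLaw M πb μ₀)) k =
        ∑ s, F t s * (M.avgR ν D s + γ * ∑ s', M.avgP ν D s s' * (θ w ⬝ᵥ φ s')) +
        γ * ∑ s, G t s * ((RL.value M γ (π w) s - θ w ⬝ᵥ φ s) - γ * ∑ s',
          M.avgP ν (π w).dens s s' * (RL.value M γ (π w) s' - θ w ⬝ᵥ φ s')) := by
      rw [eval_integral_piLp (hint t)]
      simp only [hcoord]
      rw [integral_add (hF' t k).1 ((hG' t k (hG t)).1.const_mul γ), integral_const_mul,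
        (hF' t k).2, (hG' t k (hG t)).2]
      simp only [RL.avgR_add_sub_eq hγ0 hγ1 (hr w), hw.sum_avgP_densDeriv (hr w), zero_mul,
        sub_zero]
      rfl
    have hlim : Tendsto (fun t =>
        ∑ s, F t s * (M.avgR ν D s + γ * ∑ s', M.avgP ν D s s' * (θ w ⬝ᵥ φ s')) +
        γ * ∑ s, G t s * ((RL.value M γ (π w) s - θ w ⬝ᵥ φ s) - γ * ∑ s',
          M.avgP ν (π w).dens s s' * (RL.value M γ (π w) s' - θ w ⬝ᵥ φ s'))) atTop (𝓝 _) :=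
      (tendsto_finsetSum _ fun s _ => (hFlim s).mul_const _).add
        ((tendsto_finsetSum _ fun s _ => (hGlim s).mul_const _).const_mul γ)
    simp only [hval]
    convert hlim using 2
    have hgrad : ∇ (RL.objective d φ θ) w k =
        ∑ s, d s * fderiv ℝ (fun v => RL.value M γ (π v) s) w (EuclideanSpace.single k 1) := by
      rw [RL.gradient_apply, hobj, fderiv_fun_sum fun s _ => (hV s).const_mul _, sum_apply]
      refine Finset.sum_congr rfl fun s _ => ?_
      rw [fderiv_const_mul (hV s)]
      rfl
    -- This replaces `d ∂V` by `f (1 - γ P) ∂V` and `g (1 - γ P)(V - Φθ)` by `f ∂P (V - Φθ)`. With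
    -- the differentiated Bellman equation, both sides become `f` applied to a vector and the `Φθ`
    -- terms cancel.
    rw [hgrad, ← RL.sum_mul_sub_discounted hf, RL.sum_mul_sub_discounted hg]
    have hB (s : S) := sub_eq_of_eq_add
      (hw.fderiv_value hγ0 hγ1 hr (EuclideanSpace.single k 1) s)
    simp only [hB]
    simp only [mul_add, mul_sub, Finset.sum_add_distrib, Finset.sum_sub_distrib, Finset.sum_mul,
      Finset.mul_sum]
    rw [Finset.sum_comm (f := fun s' s => γ * (f s * M.avgP ν D s s' * RL.value M γ (π w) s')),
      Finset.sum_comm (f := fun s' s => γ * (f s * M.avgP ν D s s' * (θ w ⬝ᵥ φ s')))]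
    simp only [mul_left_comm γ, mul_assoc]
    ring
  exact ((PiLp.continuous_toLp 2 _).tendsto _).comp hpi
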